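/- Let $K$ be an algebraically closed field of characteristic zero (for instance $K=\mathbb C$), and let $\mathfrak g=\mathfrak g_{\overline 0}\oplus\mathfrak g_{\overline 1}$ be a finite-dimensional Lie superalgebra over $K$. Let $U(\mathfrak g)$ be its enveloping algebra, i.e. the quotient of the tensor algebra of $\mathfrak g$ by the relations $xy-(-1)^{[x][y]}yx=[x,y]$ for homogeneous $x,y\in\mathfrak g$ of degrees $[x],[y]$, and let $\varepsilon:U(\mathfrak g)\to K$ be its counit, i.e. the algebra homomorphism that vanishes on $\mathfrak g$. Let $U(\mathfrak g)\mathfrak g_{\overline 0}$ be the left ideal of $U(\mathfrak g)$ generated by $\mathfrak g_{\overline 0}$, and let $\mathrm{ad}'$ be the representation of the Lie algebra $\mathfrak g_{\overline 0}$ in $\mathfrak g_{\overline 1}$ given by the adjoint representation of $\mathfrak g$. Then the subspace $$\{z\in U(\mathfrak g)/U(\mathfrak g)\mathfrak g_{\overline 0} \;:\; u\cdot z=\varepsilon(u)\,z\ \text{ for all } u\in U(\mathfrak g)\}$$ of invariant elements of the left $U(\mathfrak g)$-module $U(\mathfrak g)/U(\mathfrak g)\mathfrak g_{\overline 0}$ is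 at most one-dimensional, and it is one-dimensional if and only if $$\mathrm{Tr}(\mathrm{ad}'(X))=0\quad\text{for all } X\in\mathfrak g_{\overline 0}.$$ -/

import Mathlib

/-- A Lie superalgebra structure on the `K`-vector space `L`: a `ZMod 2`-grading
`L = L₀ ⊕ L₁` and an even bilinear bracket that is super-skew-symmetric and satisfies the
super Jacobi identity (the last two being conditions on homogeneous elements). -/
structure LieSuperalgebra (K : Type*) [Field K] (L : Type*) [AddCommGroup L] [Module K L] where
  /-- The homogeneous components. -/
  grading : ZMod 2 → Submodule K L
  /-- The space is the direct sum of its even and its odd component. -/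
  isCompl : IsCompl (grading 0) (grading 1)
  /-- The superbracket. -/
  bracket : L →ₗ[K] L →ₗ[K] L
  bracket_mem : ∀ {i j : ZMod 2} {x y : L}, x ∈ grading i → y ∈ grading j →
    bracket x y ∈ grading (i + j)
  bracket_skew : ∀ {i j : ZMod 2} {x y : L}, x ∈ grading i → y ∈ grading j →
    bracket x y = -((-1 : K) ^ (i.val * j.val) • bracket y x)
  jacobi : ∀ {i j : ZMod 2} {x y : L}, x ∈ grading i → y ∈ grading j → ∀ z : L,
    bracket x (bracket y z) =
      bracket (bracket x y) z + (-1 : K) ^ (i.val * j.val) • bracket y (bracket x z)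

namespace LieSuperalgebra

section

variable {K : Type*} [Field K] {L : Type*} [AddCommGroup L] [Module K L]

/-- The even part, a Lie algebra. -/
def even (g : LieSuperalgebra K L) : Submodule K L := g.grading 0

/-- The odd part. -/
def odd (g : LieSuperalgebra K L) : Submodule K L := g.grading 1

theorem bracket_even_odd (g : LieSuperalgebra K L) {x y : L} (hx : x ∈ g.even)
    (hy : y ∈ g.odd) : g.bracket x y ∈ g.odd := by
  have h := g.bracket_mem hx hy
  rwa [zero_add] at h

/-- The action of the even part on the odd part given by the adjoint representation. -/
def adOdd (g : LieSuperalgebra K L) : g.even →ₗ[K] Module.End K g.odd where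
  toFun X := (g.bracket (X : L)).restrict fun _ hy => g.bracket_even_odd X.2 hy
  map_add' X Y := by ext; simp
  map_smul' c X := by ext; simp

/-- The defining relations `x y - (-1)^{[x][y]} y x = [x, y]`, for homogeneous `x` and `y`, of the
enveloping algebra, imposed on the tensor algebra. -/
inductive EnvelopingRel (g : LieSuperalgebra K L) : TensorAlgebra K L → TensorAlgebra K L → Prop
  | of {i j : ZMod 2} {x y : L} (hx : x ∈ g.grading i) (hy : y ∈ g.grading j) :
      EnvelopingRel g
        (TensorAlgebra.ι K x * TensorAlgebra.ι K y -
          (-1 : K) ^ (i.val * j.val) • (TensorAlgebra.ι K y * TensorAlgebra.ι K x))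
        (TensorAlgebra.ι K (g.bracket x y))

/-- The (universal) enveloping algebra of a Lie superalgebra. -/
def Enveloping (g : LieSuperalgebra K L) : Type _ := RingQuot g.EnvelopingRel

noncomputable instance (g : LieSuperalgebra K L) : Ring g.Enveloping :=
  inferInstanceAs (Ring (RingQuot g.EnvelopingRel))

noncomputable instance (g : LieSuperalgebra K L) : Algebra K g.Enveloping :=
  inferInstanceAs (Algebra K (RingQuot g.EnvelopingRel))

/-- The canonical map of a Lie superalgebra into its enveloping algebra. -/
noncomputable def toEnveloping (g : LieSuperalgebra K L) : L →ₗ[K] g.Enveloping :=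
  (RingQuot.mkAlgHom K g.EnvelopingRel).toLinearMap ∘ₗ TensorAlgebra.ι K

/-- The counit of the enveloping algebra: the algebra homomorphism to the base field that vanishes
on the Lie superalgebra. -/
noncomputable def counit (g : LieSuperalgebra K L) : g.Enveloping →ₐ[K] K :=
  RingQuot.liftAlgHom K ⟨TensorAlgebra.lift K (0 : L →ₗ[K] K), fun _ _ h => by
    cases h; simp⟩

theorem counit_toEnveloping (g : LieSuperalgebra K L) (x : L) :
    g.counit (g.toEnveloping x) = 0 := by
  refine (RingQuot.liftAlgHom_mkAlgHom_apply (S := K) _ _ _).trans ?_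
  simp

/-- The left ideal of the enveloping algebra generated by the even part. -/
noncomputable def evenIdeal (g : LieSuperalgebra K L) : Submodule g.Enveloping g.Enveloping :=
  Submodule.span g.Enveloping (g.toEnveloping '' g.even)

/-- The subspace of invariant elements of a module `M` over the enveloping algebra: those on which
the enveloping algebra acts through its counit. -/
noncomputable def invariants (g : LieSuperalgebra K L) (M : Type*) [AddCommGroup M] [Module K M]
    [Module g.Enveloping M] [IsScalarTower K g.Enveloping M] : Submodule K M where
  carrier := {m | ∀ u : g.Enveloping, u • m = g.counit u • m}
  zero_mem' u := by simp
  add_mem' {a b} ha hb u := by rw [smul_add, smul_add, ha u, hb u]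
  smul_mem' c m hm u := by
    have h : u • c • m = c • u • m := by
      rw [← algebraMap_smul g.Enveloping c m, smul_smul, ← Algebra.commutes c u, ← smul_smul,
        algebraMap_smul]
    rw [h, hm u, smul_comm]

end

end LieSuperalgebra

/-!
The module `M = U(g) / U(g) g₀` is identified with the exterior algebra `Λ` of the odd part `V`,
after which its invariant elements can be read off in the top degree.

**A deformed multiplication on `Λ`.** The even part acts on `Λ` by the derivations `der (ad X)`.
Operators `P y`, for `y` odd, are constructed that lower the degree and for which
`L y = y ∧ · + P y` satisfies `L y L z + L z L y = der (ad [y, z])`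
(`ExteriorAlgebra.exists_isDeformation`). They solve
`P y ∘ (degree + 1) = ∑ j, R(y, e j) ∘ ∂ j`, where `e` is a basis of `V`, the `∂ j` are the
contractions by the dual basis, and `R(y, z) = der (ad [y, z]) - L z P y - L y P z`. This equation
determines `P` degree by degree, and division by the degree is where characteristic zero is used.
The obstruction `Z(y, z) = P y (z ∧ ·) + P z (y ∧ ·) - R(y, z)` to the desired relation then satisfies
`Z(y, z) (degree + 2) = -∑ j, (cyclic sum over y, z, e j of Z P - L Z) ∘ ∂ j`, by the Jacobi
identity, so it vanishes by induction on the degree. This makes `Λ` a `g`-module, and replaces the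
Poincaré-Birkhoff-Witt theorem.

**Universal property.** The same method shows that a vector annihilated by the even part in any
`g`-module is the image of `1 ∈ Λ` under a `g`-linear map
(`ExteriorAlgebra.IsDeformation.exists_intertwining`). Since `Λ` is generated by `1`, it follows
that `M` and `Λ` are isomorphic (`LieSuperalgebra.exists_equiv_exteriorAlgebra`).

**Invariant elements.** Below the top degree `n`, the part of highest degree of an element is not
annihilated by all `y ∧ ·`. Hence a nonzero subspace of `Λ` that is stable under all `L y` contains an
element with nonzero component of degree `n` (`ExteriorAlgebra.eq_bot_of_stable`), and as the top
degree is one-dimensional, so is at most the space of invariant elements. The derivation `der A` acts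
on the top degree by `Tr A`, so a nonzero invariant element forces `Tr (ad' X) = 0`. Conversely, if
the traces vanish, the top degree form `t` is annihilated by the even part. By the universal
property there is a `g`-linear map from `Λ` to its (twisted) dual with `1 ↦ t`. By the same fact on
stable subspaces it is bijective, and the preimage of the counit is a nonzero invariant element
(`LieSuperalgebra.exists_invariant_of_trace_eq_zero`).
-/

/-! ### Exterior multiplication and contraction -/

namespace ExteriorAlgebra

variable {K V : Type*} [Field K] [AddCommGroup V] [Module K V]

/-- Left multiplication by a vector on the exterior algebra. -/
noncomputable def wedge : V →ₗ[K] Module.End K (ExteriorAlgebra K V) :=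
  (LinearMap.mul K (ExteriorAlgebra K V)) ∘ₗ ι K

/-- Left contraction of the exterior algebra by a covector. -/
noncomputable def contr : Module.Dual K V →ₗ[K] Module.End K (ExteriorAlgebra K V) :=
  CliffordAlgebra.contractLeft (Q := (0 : QuadraticForm K V))

theorem wedge_apply (y : V) (w : ExteriorAlgebra K V) : wedge y w = ι K y * w := rfl

theorem wedge_mul_wedge (y z : V) :
    (wedge y * wedge z + wedge z * wedge y : Module.End K (ExteriorAlgebra K V)) = 0 := by
  refine LinearMap.ext fun w => ?_
  simp only [LinearMap.add_apply, Module.End.mul_apply, wedge_apply, ← mul_assoc, ← add_mul,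
    ι_add_mul_swap, zero_mul, LinearMap.zero_apply]

theorem contr_wedge (d : Module.Dual K V) (y : V) (w : ExteriorAlgebra K V) :
    contr d (wedge y w) = d y • w - wedge y (contr d w) :=
  CliffordAlgebra.contractLeft_ι_mul ..

theorem contr_contr (d d' : Module.Dual K V) (w : ExteriorAlgebra K V) :
    contr d (contr d' w) = -contr d' (contr d w) :=
  CliffordAlgebra.contractLeft_comm ..

theorem contr_one (d : Module.Dual K V) : contr d (1 : ExteriorAlgebra K V) = 0 :=
  CliffordAlgebra.contractLeft_one ..

/-! ### The degree filtration -/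

/-- The operator on the exterior algebra that multiplies the component of degree `i` by `f i`. -/
noncomputable def scale (f : ℕ → K) : Module.End K (ExteriorAlgebra K V) :=
  DirectSum.coeLinearMap (fun i : ℕ => ⋀[K]^i V) ∘ₗ
    DirectSum.lmap (fun i => f i • LinearMap.id) ∘ₗ
    (DirectSum.decomposeLinearEquiv (fun i : ℕ => ⋀[K]^i V)).toLinearMap

theorem scale_of_mem (f : ℕ → K) {i : ℕ} {w : ExteriorAlgebra K V} (hw : w ∈ ⋀[K]^i V) :
    scale f w = f i • w := by
  lift w to ⋀[K]^i V using hw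
  simp [scale]

theorem linearMap_ext_degree {W : Type*} [AddCommGroup W] [Module K W]
    {f f' : ExteriorAlgebra K V →ₗ[K] W} (h : ∀ i, ∀ w ∈ ⋀[K]^i V, f w = f' w) : f = f' := by
  refine LinearMap.ext fun w => ?_
  induction w using DirectSum.Decomposition.inductionOn fun i : ℕ => ⋀[K]^i V with
  | zero => simp
  | homogeneous m => exact h _ _ m.2
  | add x y hx hy => rw [map_add, map_add, hx, hy]

theorem scale_mul (f f' : ℕ → K) :
    (scale f * scale f' : Module.End K (ExteriorAlgebra K V)) = scale (f * f') :=
  linearMap_ext_degree fun i w hw => by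
    rw [Module.End.mul_apply, scale_of_mem f' hw, map_smul, scale_of_mem f hw, scale_of_mem _ hw,
      smul_smul, mul_comm, Pi.mul_apply]

theorem scale_one : (scale 1 : Module.End K (ExteriorAlgebra K V)) = 1 :=
  linearMap_ext_degree fun i w hw => by simp [scale_of_mem _ hw]

/-- The elements of the exterior algebra all of whose components have degree less than `k`. -/
def degLT (K V : Type*) [Field K] [AddCommGroup V] [Module K V] (k : ℕ) :
    Submodule K (ExteriorAlgebra K V) :=
  ⨆ i, ⨆ _ : i < k, ⋀[K]^i V

theorem degLT_le {k : ℕ} {p : Submodule K (ExteriorAlgebra K V)} :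
    degLT K V k ≤ p ↔ ∀ i < k, ⋀[K]^i V ≤ p := iSup₂_le_iff

theorem exteriorPower_le_degLT {i k : ℕ} (h : i < k) : ⋀[K]^i V ≤ degLT K V k :=
  le_iSup₂_of_le i h le_rfl

theorem degLT_mono {k l : ℕ} (h : k ≤ l) : degLT K V k ≤ degLT K V l :=
  degLT_le.2 fun _ hi => exteriorPower_le_degLT (hi.trans_le h)

theorem degLT_zero : degLT K V 0 = ⊥ :=
  le_bot_iff.1 (degLT_le.2 fun _ hi => absurd hi (Nat.not_lt_zero _))

theorem scale_mem (f : ℕ → K) {k : ℕ} {w : ExteriorAlgebra K V} (hw : w ∈ degLT K V k) :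
    scale f w ∈ degLT K V k := by
  refine degLT_le (p := (degLT K V k).comap (scale f)) |>.2 (fun i hi w hw => ?_) hw
  rw [Submodule.mem_comap, scale_of_mem f hw]
  exact Submodule.smul_mem _ _ (exteriorPower_le_degLT hi hw)

theorem scale_eq_self {f : ℕ → K} {k : ℕ} (hf : ∀ i < k, f i = 1) {w : ExteriorAlgebra K V}
    (hw : w ∈ degLT K V k) : scale f w = w := by
  refine degLT_le (p := LinearMap.eqLocus (scale f) LinearMap.id) |>.2 (fun i hi w hw => ?_) hw
  rw [LinearMap.mem_eqLocus, scale_of_mem f hw, hf i hi, one_smul, LinearMap.id_apply]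

theorem wedge_mem_exteriorPower (y : V) {i : ℕ} {w : ExteriorAlgebra K V} (hw : w ∈ ⋀[K]^i V) :
    wedge y w ∈ ⋀[K]^(i + 1) V := by
  rw [exteriorPower, pow_succ']
  exact Submodule.mul_mem_mul ⟨y, rfl⟩ hw

theorem scale_mul_wedge (f : ℕ → K) (y : V) :
    scale f * wedge y = wedge y * scale fun i => f (i + 1) :=
  linearMap_ext_degree fun i w hw => by
    rw [Module.End.mul_apply, Module.End.mul_apply, scale_of_mem _ hw, map_smul,
      scale_of_mem _ (wedge_mem_exteriorPower y hw)]

theorem wedge_mem (y : V) {k : ℕ} {w : ExteriorAlgebra K V} (hw : w ∈ degLT K V k) :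
    wedge y w ∈ degLT K V (k + 1) := by
  refine degLT_le (p := (degLT K V (k + 1)).comap (wedge y)) |>.2 (fun i hi w hw => ?_) hw
  exact exteriorPower_le_degLT (by omega) (wedge_mem_exteriorPower y hw)

theorem exteriorPower_succ_induction {i : ℕ} {p : Submodule K (ExteriorAlgebra K V)}
    (h : ∀ y, ∀ w ∈ ⋀[K]^i V, wedge y w ∈ p) : ⋀[K]^(i + 1) V ≤ p := by
  rw [exteriorPower, pow_succ', Submodule.mul_le]
  rintro _ ⟨y, rfl⟩ w hw
  exact h y w hw

theorem mem_exteriorPower_zero {w : ExteriorAlgebra K V} (hw : w ∈ ⋀[K]^0 V) :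
    ∃ c : K, w = c • 1 := by
  rw [exteriorPower, pow_zero, Submodule.mem_one] at hw
  obtain ⟨c, rfl⟩ := hw
  exact ⟨c, Algebra.algebraMap_eq_smul_one c⟩

theorem contr_eq_zero (d : Module.Dual K V) {w : ExteriorAlgebra K V} (hw : w ∈ ⋀[K]^0 V) :
    contr d w = 0 := by
  obtain ⟨c, rfl⟩ := mem_exteriorPower_zero hw
  rw [map_smul, contr_one, smul_zero]

theorem contr_mem_exteriorPower (d : Module.Dual K V) (i : ℕ) :
    ⋀[K]^(i + 1) V ≤ (⋀[K]^i V).comap (contr d) := by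
  induction i with
  | zero =>
    refine exteriorPower_succ_induction fun y w hw => ?_
    rw [Submodule.mem_comap, contr_wedge, contr_eq_zero d hw, map_zero, sub_zero]
    exact Submodule.smul_mem _ _ hw
  | succ i ih =>
    refine exteriorPower_succ_induction fun y w hw => ?_
    rw [Submodule.mem_comap, contr_wedge]
    exact Submodule.sub_mem _ (Submodule.smul_mem _ _ hw) (wedge_mem_exteriorPower y (ih hw))

theorem contr_mem (d : Module.Dual K V) {k : ℕ} {w : ExteriorAlgebra K V}
    (hw : w ∈ degLT K V (k + 1)) : contr d w ∈ degLT K V k := by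
  refine degLT_le (p := (degLT K V k).comap (contr d)) |>.2 (fun i hi w hw => ?_) hw
  rw [Submodule.mem_comap]
  cases i with
  | zero => rw [contr_eq_zero d hw]; exact Submodule.zero_mem _
  | succ i => exact exteriorPower_le_degLT (by omega) (contr_mem_exteriorPower d i hw)

theorem exteriorPower_eq_bot [FiniteDimensional K V] {i : ℕ} (hi : Module.finrank K V < i) :
    ⋀[K]^i V = ⊥ := by
  rw [← Submodule.finrank_eq_zero (R := K), exteriorPower.finrank_eq, Nat.choose_eq_zero_of_lt hi]

theorem degLT_eq_top [FiniteDimensional K V] : degLT K V (Module.finrank K V + 1) = ⊤ := by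
  refine top_le_iff.1 fun w _ => ?_
  induction w using DirectSum.Decomposition.inductionOn fun i : ℕ => ⋀[K]^i V with
  | zero => exact Submodule.zero_mem _
  | @homogeneous i m =>
    rcases lt_or_ge i (Module.finrank K V + 1) with h | h
    · exact exteriorPower_le_degLT h m.2
    · have hm : (m : ExteriorAlgebra K V) = 0 := by
        rw [← Submodule.mem_bot K, ← exteriorPower_eq_bot (K := K) (V := V) (i := i) (by omega)]
        exact m.2
      rw [hm]
      exact Submodule.zero_mem _
  | add x y hx hy => exact Submodule.add_mem _ (hx trivial) (hy trivial)

instance [FiniteDimensional K V] : FiniteDimensional K (ExteriorAlgebra K V) := by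
  have h : FiniteDimensional K (degLT K V (Module.finrank K V + 1)) := by
    have (i : ℕ) : FiniteDimensional K (⨆ _ : i < Module.finrank K V + 1, ⋀[K]^i V :
        Submodule K (ExteriorAlgebra K V)) := by
      by_cases hi : i < Module.finrank K V + 1
      · rw [iSup_pos hi]; infer_instance
      · rw [iSup_neg hi]; infer_instance
    have e : degLT K V (Module.finrank K V + 1) =
        ⨆ j : Fin (Module.finrank K V + 1), ⋀[K]^(j : ℕ) V := by
      rw [degLT, iSup_subtype' (p := fun i => i < Module.finrank K V + 1)]
      exact (Fin.equivSubtype.symm.iSup_congr fun _ => rfl)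
    rw [e]
    infer_instance
  rw [degLT_eq_top] at h
  exact Module.Finite.of_surjective _ (Submodule.topEquiv (R := K)).surjective

end ExteriorAlgebra

namespace ExteriorAlgebra

open Module (finBasis finrank)

/-! ### Polarization and derivations -/

variable {K V : Type*} [Field K] [AddCommGroup V] [Module K V] [FiniteDimensional K V]
  {W W' : Type*} [AddCommGroup W] [Module K W] [AddCommGroup W'] [Module K W']

/-- The operator `∑ j, T (e j) ∘ ∂ j`, where `e` is a basis and `∂ j` is the contraction by the
`j`-th covector of the dual basis. It does not depend on the basis if `T` is linear, but `T` is
allowed to be any function here. -/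
noncomputable def polar (T : V → ExteriorAlgebra K V →ₗ[K] W) : ExteriorAlgebra K V →ₗ[K] W :=
  ∑ j, T (finBasis K V j) ∘ₗ contr ((finBasis K V).coord j)

theorem polar_apply (T : V → ExteriorAlgebra K V →ₗ[K] W) (w : ExteriorAlgebra K V) :
    polar T w = ∑ j, T (finBasis K V j) (contr ((finBasis K V).coord j) w) := by
  simp [polar]

theorem polar_add (T T' : V → ExteriorAlgebra K V →ₗ[K] W) :
    polar (fun z => T z + T' z) = polar T + polar T' := by
  simp [polar, LinearMap.add_comp, Finset.sum_add_distrib]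

theorem polar_neg (T : V → ExteriorAlgebra K V →ₗ[K] W) :
    polar (fun z => -T z) = -polar T := by
  simp [polar, LinearMap.neg_comp]

theorem polar_sub (T T' : V → ExteriorAlgebra K V →ₗ[K] W) :
    polar (fun z => T z - T' z) = polar T - polar T' := by
  simp [polar, LinearMap.sub_comp]

theorem comp_polar (f : W →ₗ[K] W') (T : V → ExteriorAlgebra K V →ₗ[K] W) :
    polar (fun z => f ∘ₗ T z) = f ∘ₗ polar T := by
  refine LinearMap.ext fun w => ?_
  simp [polar_apply]

/-- `polar` as a linear map, on linear families of operators. -/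
noncomputable def polarLin :
    (V →ₗ[K] ExteriorAlgebra K V →ₗ[K] W) →ₗ[K] ExteriorAlgebra K V →ₗ[K] W where
  toFun T := polar T
  map_add' T T' := polar_add T T'
  map_smul' c T := by
    refine LinearMap.ext fun w => ?_
    simp [polar_apply, Finset.smul_sum]

theorem polar_one (T : V → ExteriorAlgebra K V →ₗ[K] W) : polar T 1 = 0 := by
  simp [polar_apply, contr_one]

theorem polar_congr {T T' : V → ExteriorAlgebra K V →ₗ[K] W} {k : ℕ}
    (h : ∀ z, ∀ w ∈ degLT K V k, T z w = T' z w) {w : ExteriorAlgebra K V}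
    (hw : w ∈ degLT K V (k + 1)) : polar T w = polar T' w := by
  simp only [polar_apply]
  exact Finset.sum_congr rfl fun j _ => h _ _ (contr_mem _ hw)

theorem polar_eq_zero {T : V → ExteriorAlgebra K V →ₗ[K] W} {k : ℕ}
    (h : ∀ z, ∀ w ∈ degLT K V k, T z w = 0) {w : ExteriorAlgebra K V}
    (hw : w ∈ degLT K V (k + 1)) : polar T w = 0 := by
  rw [polar_apply]
  exact Finset.sum_eq_zero fun j _ => h _ _ (contr_mem _ hw)

theorem polar_mem {T : V → ExteriorAlgebra K V →ₗ[K] W} {k : ℕ} {p : Submodule K W}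
    (h : ∀ z, ∀ w ∈ degLT K V k, T z w ∈ p) {w : ExteriorAlgebra K V}
    (hw : w ∈ degLT K V (k + 1)) : polar T w ∈ p := by
  rw [polar_apply]
  exact Submodule.sum_mem _ fun j _ => h _ _ (contr_mem _ hw)

/-- As contractions are antiderivations, `polar T` differentiates the factor `y`. -/
theorem polar_comp_wedge (T : V →ₗ[K] ExteriorAlgebra K V →ₗ[K] W) (y : V) :
    polar T ∘ₗ wedge y = T y - polar fun z => T z ∘ₗ wedge y := by
  refine LinearMap.ext fun w => ?_
  have h : T y w = ∑ j, ((finBasis K V).coord j y) • T (finBasis K V j) w := by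
    conv_lhs => rw [← (finBasis K V).sum_repr y, map_sum, LinearMap.sum_apply]
    simp
  rw [LinearMap.sub_apply, h, polar_apply, LinearMap.comp_apply, polar_apply,
    ← Finset.sum_sub_distrib]
  refine Finset.sum_congr rfl fun j _ => ?_
  rw [contr_wedge, map_sub, map_smul, LinearMap.comp_apply]

/-- The derivation of the exterior algebra that extends an endomorphism of the vector space. -/
noncomputable def der : Module.End K V →ₗ[K] Module.End K (ExteriorAlgebra K V) where
  toFun A := polar fun z => wedge (A z)
  map_add' A B := by
    rw [← polar_add]; simp only [LinearMap.add_apply, map_add]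
  map_smul' c A := by
    have h := comp_polar (c • (LinearMap.id : Module.End K (ExteriorAlgebra K V)))
      fun z => wedge (A z)
    rw [LinearMap.smul_comp, LinearMap.id_comp] at h
    rw [RingHom.id_apply, ← h]
    simp only [LinearMap.smul_apply, map_smul, LinearMap.smul_comp, LinearMap.id_comp]

theorem der_apply_eq (A : Module.End K V) : der A = polar fun z => wedge (A z) := rfl

theorem der_one (A : Module.End K V) : der A (1 : ExteriorAlgebra K V) = 0 := polar_one _

theorem der_mul_wedge (A : Module.End K V) (y : V) :
    der A * wedge y = wedge (A y) + wedge y * der A := by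
  have h := polar_comp_wedge (wedge ∘ₗ A) y
  have h2 : (fun z => (wedge ∘ₗ A) z ∘ₗ wedge y) =
      fun z => -(wedge y ∘ₗ (wedge (A z) : Module.End K (ExteriorAlgebra K V))) :=
    funext fun z => eq_neg_of_add_eq_zero_left (wedge_mul_wedge (A z) y)
  rw [h2, polar_neg, comp_polar, sub_neg_eq_add] at h
  exact h

/-- The commutator of a contraction and a derivation is the contraction by the transposed covector. -/
theorem contr_der (A : Module.End K V) (d : Module.Dual K V) (w : ExteriorAlgebra K V) :
    contr d (der A w) = contr (d ∘ₗ A) w + der A (contr d w) := by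
  have h : contr (d ∘ₗ A) =
      ∑ j, d (A (finBasis K V j)) • (contr ((finBasis K V).coord j) :
        Module.End K (ExteriorAlgebra K V)) := by
    rw [← (finBasis K V).sum_dual_apply_smul_coord (d ∘ₗ A), map_sum]
    simp
  rw [h, der_apply_eq, polar_apply, map_sum, polar_apply, LinearMap.sum_apply,
    ← Finset.sum_add_distrib]
  refine Finset.sum_congr rfl fun j _ => ?_
  rw [contr_wedge, contr_contr, map_neg, sub_neg_eq_add, LinearMap.smul_apply]

/-- `polar` is equivariant: its commutator with a derivation acts on the family `T` alone. -/
theorem polar_comp_der (T : V →ₗ[K] ExteriorAlgebra K V →ₗ[K] W) (A : Module.End K V) :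
    polar T ∘ₗ der A = polar (fun z => T z ∘ₗ der A) + polar fun z => T (A z) := by
  have key (w : ExteriorAlgebra K V) :
      ∑ j, T (finBasis K V j) (contr ((finBasis K V).coord j ∘ₗ A) w) =
        ∑ j, T (A (finBasis K V j)) (contr ((finBasis K V).coord j) w) := by
    have h1 (j) : T (finBasis K V j) (contr ((finBasis K V).coord j ∘ₗ A) w) =
        ∑ k, ((finBasis K V).coord j (A (finBasis K V k))) •
          T (finBasis K V j) (contr ((finBasis K V).coord k) w) := by
      conv_lhs => rw [← (finBasis K V).sum_dual_apply_smul_coord ((finBasis K V).coord j ∘ₗ A)]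
      simp
    have h2 (k) : T (A (finBasis K V k)) (contr ((finBasis K V).coord k) w) =
        ∑ j, ((finBasis K V).coord j (A (finBasis K V k))) •
          T (finBasis K V j) (contr ((finBasis K V).coord k) w) := by
      conv_lhs => rw [← (finBasis K V).sum_repr (A (finBasis K V k)), map_sum, LinearMap.sum_apply]
      simp
    simp_rw [h1, h2]
    exact Finset.sum_comm
  refine LinearMap.ext fun w => ?_
  simp only [LinearMap.comp_apply, LinearMap.add_apply, polar_apply, contr_der, map_add,
    Finset.sum_add_distrib, ← key]
  exact add_comm _ _

theorem der_lie (A B : Module.End K V) :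
    (der (A * B - B * A) : Module.End K (ExteriorAlgebra K V)) = der A * der B - der B * der A := by
  have h := polar_comp_der (wedge ∘ₗ B) A
  have h2 : (fun z => (wedge ∘ₗ B) z ∘ₗ der A) =
      fun z => der A ∘ₗ wedge (B z) - (wedge (A (B z)) : Module.End K (ExteriorAlgebra K V)) :=
    funext fun z => eq_sub_of_add_eq' (der_mul_wedge A (B z)).symm
  rw [h2, polar_sub, comp_polar] at h
  have h3 : der B * der A = der A * der B - der (A * B) + der (B * A) := h
  rw [map_sub, h3]
  abel

theorem der_mem_exteriorPower (A : Module.End K V) (i : ℕ) :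
    ⋀[K]^i V ≤ (⋀[K]^i V).comap (der A) := by
  induction i with
  | zero =>
    intro w hw
    obtain ⟨c, rfl⟩ := mem_exteriorPower_zero hw
    rw [Submodule.mem_comap, map_smul, der_one, smul_zero]
    exact Submodule.zero_mem _
  | succ i ih =>
    refine exteriorPower_succ_induction fun y w hw => ?_
    rw [Submodule.mem_comap, ← Module.End.mul_apply, der_mul_wedge]
    exact Submodule.add_mem _ (wedge_mem_exteriorPower _ hw) (wedge_mem_exteriorPower _ (ih hw))

theorem der_mem (A : Module.End K V) {k : ℕ} {w : ExteriorAlgebra K V}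
    (hw : w ∈ degLT K V k) : der A w ∈ degLT K V k := by
  refine degLT_le (p := (degLT K V k).comap (der A)) |>.2 (fun i hi w hw => ?_) hw
  exact exteriorPower_le_degLT hi (der_mem_exteriorPower A i hw)

theorem der_mul_scale (f : ℕ → K) (A : Module.End K V) :
    der A * scale f = scale f * der A :=
  linearMap_ext_degree fun i w hw => by
    rw [Module.End.mul_apply, Module.End.mul_apply, scale_of_mem _ hw, map_smul,
      scale_of_mem _ (der_mem_exteriorPower A i hw)]

/-- The derivation that extends the identity multiplies each homogeneous element by its degree. -/
theorem der_id : (der 1 : Module.End K (ExteriorAlgebra K V)) = scale fun i => (i : K) := by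
  refine linearMap_ext_degree fun i => ?_
  suffices ⋀[K]^i V ≤ LinearMap.eqLocus (der 1) (scale fun i => (i : K)) from this
  induction i with
  | zero =>
    intro w hw
    rw [LinearMap.mem_eqLocus, scale_of_mem _ hw]
    obtain ⟨c, rfl⟩ := mem_exteriorPower_zero hw
    simp [der_one]
  | succ i ih =>
    refine exteriorPower_succ_induction fun y w hw => ?_
    rw [LinearMap.mem_eqLocus, ← Module.End.mul_apply, der_mul_wedge, LinearMap.add_apply,
      Module.End.mul_apply, (ih hw : der 1 w = _), scale_of_mem _ hw, map_smul,
      scale_of_mem _ (wedge_mem_exteriorPower y hw)]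
    simp [add_smul, add_comm]

/-- The scaling by `degree + a`. -/
theorem scale_natCast_add (a : ℕ) :
    (scale fun i => ((i + a : ℕ) : K) : Module.End K (ExteriorAlgebra K V)) = der 1 + (a : K) • 1 :=
  linearMap_ext_degree fun i w hw => by
    rw [der_id, LinearMap.add_apply, scale_of_mem _ hw, scale_of_mem _ hw, Nat.cast_add, add_smul]
    rfl

theorem sum_contr_wedge (w : ExteriorAlgebra K V) :
    ∑ j, contr ((finBasis K V).coord j) (wedge (finBasis K V j) w) =
      (finrank K V : K) • w - der 1 w := by
  simp [contr_wedge, der_apply_eq, polar_apply, ← Nat.cast_smul_eq_nsmul K]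

/-- A derivation acts by the trace on an element annihilated by all exterior multiplications. -/
theorem der_eq_trace_smul (A : Module.End K V) {w : ExteriorAlgebra K V}
    (hw : ∀ y, wedge y w = 0) : der A w = LinearMap.trace K V A • w := by
  rw [LinearMap.trace_eq_matrix_trace K (finBasis K V), der_apply_eq, polar_apply, Matrix.trace,
    Finset.sum_smul]
  refine Finset.sum_congr rfl fun j _ => ?_
  have h := contr_wedge ((finBasis K V).coord j) (A (finBasis K V j)) w
  rw [hw, map_zero] at h
  rw [← sub_eq_zero.1 h.symm, Matrix.diag_apply, LinearMap.toMatrix_apply]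
  rfl

end ExteriorAlgebra

/-! ### The deformed exterior multiplication -/

/-- A map has a fixed point if it carries approximations of order `k` to approximations of order
`k + 1`, where approximation of order `N` is equality. -/
theorem exists_fixedPoint_of_approx {T : Type*} (G : T → T) (good : T → Prop)
    (r : ℕ → T → T → Prop) (N : ℕ) (x₀ : T) (h₀ : good x₀) (hG : ∀ x, good x → good (G x))
    (r_zero : ∀ x y, r 0 x y)
    (r_succ : ∀ k x y, good x → good y → r k x y → r (k + 1) (G x) (G y))
    (r_eq : ∀ x y, r N x y → x = y) : ∃ x, good x ∧ G x = x := by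
  have hgood (k : ℕ) : good (G^[k] x₀) := by
    induction k with
    | zero => exact h₀
    | succ k ih => rw [Function.iterate_succ_apply']; exact hG _ ih
  have hr (k : ℕ) : r k (G^[k + 1] x₀) (G^[k] x₀) := by
    induction k with
    | zero => exact r_zero _ _
    | succ k ih =>
      have := r_succ k _ _ (hgood (k + 1)) (hgood k) ih
      rwa [← Function.iterate_succ_apply' G, ← Function.iterate_succ_apply' G] at this
  refine ⟨G^[N] x₀, hgood N, ?_⟩
  rw [← Function.iterate_succ_apply' G]
  exact r_eq _ _ (hr N)

/-- An identity in a noncommutative ring: with `Lx = wx + px` and similarly for `y` and `z`, the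
operators `Zyz = py * wz + pz * wy - Ryz`, where `Ryz = dyz - Lz * py - Ly * pz`, are the obstruction
to `Ly * Lz + Lz * Ly = dyz`, and the cyclic sum of `Ryz * wx` is a combination of them. -/
theorem cyclic_obstruction_identity {R : Type*} [Ring R] {wx wy wz px py pz dyz dzx dxy : R}
    (hxy : wx * wy + wy * wx = 0) (hyz : wy * wz + wz * wy = 0) (hzx : wz * wx + wx * wz = 0)
    (hd : (dyz * (wx + px) - (wx + px) * dyz) + (dzx * (wy + py) - (wy + py) * dzx) +
      (dxy * (wz + pz) - (wz + pz) * dxy) = 0) :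
    (dyz - (wz + pz) * py - (wy + py) * pz) * wx + (dzx - (wx + px) * pz - (wz + pz) * px) * wy +
        (dxy - (wy + py) * px - (wx + px) * py) * wz =
      (py * wz + pz * wy - (dyz - (wz + pz) * py - (wy + py) * pz)) * px -
        (wx + px) * (py * wz + pz * wy - (dyz - (wz + pz) * py - (wy + py) * pz)) +
      ((pz * wx + px * wz - (dzx - (wx + px) * pz - (wz + pz) * px)) * py -
        (wy + py) * (pz * wx + px * wz - (dzx - (wx + px) * pz - (wz + pz) * px))) +
      ((px * wy + py * wx - (dxy - (wy + py) * px - (wx + px) * py)) * pz -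
        (wz + pz) * (px * wy + py * wx - (dxy - (wy + py) * px - (wx + px) * py))) := by
  linear_combination (norm := noncomm_ring) hd + hxy * pz + hyz * px + hzx * py

/-- The commutator with `a` acts on the terms of `d - lz * py - ly * pz` one at a time. -/
theorem commutator_correction_identity {R : Type*} [Ring R]
    {a d d₁ d₂ ly lz py pz lay laz pay paz : R} (hd : d₁ + d₂ = a * d - d * a)
    (hly : a * ly = lay + ly * a) (hlz : a * lz = laz + lz * a)
    (hpy : a * py = pay + py * a) (hpz : a * pz = paz + pz * a) :
    (d - lz * py - ly * pz) * a = a * (d - lz * py - ly * pz) - (d₁ - lz * pay - lay * pz) -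
      (d₂ - laz * py - ly * paz) := by
  linear_combination (norm := noncomm_ring)
    hd + lz * hpy + ly * hpz + hlz * py + hly * pz

namespace ExteriorAlgebra

open Module (finBasis finrank)

variable {K V : Type*} [Field K] [AddCommGroup V] [Module K V]

theorem lowers_mem_degLT {P : V →ₗ[K] Module.End K (ExteriorAlgebra K V)}
    (hP : ∀ y k, ∀ w ∈ degLT K V (k + 1), P y w ∈ degLT K V k) (y : V) {k : ℕ}
    {w : ExteriorAlgebra K V} (hw : w ∈ degLT K V k) : P y w ∈ degLT K V k :=
  hP y k w (degLT_mono k.le_succ hw)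

theorem wedge_add_mem_of_lowers {P : V →ₗ[K] Module.End K (ExteriorAlgebra K V)}
    (hP : ∀ y k, ∀ w ∈ degLT K V (k + 1), P y w ∈ degLT K V k) (y z : V) {k : ℕ}
    {w : ExteriorAlgebra K V} (hw : w ∈ degLT K V k) :
    ((wedge z + P z) * P y : Module.End K (ExteriorAlgebra K V)) w ∈ degLT K V k := by
  cases k with
  | zero =>
    rw [degLT_zero, Submodule.mem_bot] at hw
    rw [hw, map_zero]
    exact Submodule.zero_mem _
  | succ k =>
    have h := hP y k w hw
    exact Submodule.add_mem _ (wedge_mem z h)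
      (degLT_mono k.le_succ (lowers_mem_degLT hP z h))

variable [FiniteDimensional K V]

/-- The correction term `R(y, z) = der C(y, z) - L z * P y - L y * P z`, where `L y = y ∧ · + P y`. -/
noncomputable def correction (C : V →ₗ[K] V →ₗ[K] Module.End K V)
    (P : V →ₗ[K] Module.End K (ExteriorAlgebra K V)) :
    V →ₗ[K] V →ₗ[K] Module.End K (ExteriorAlgebra K V) :=
  LinearMap.mk₂ K (fun y z => der (C y z) - (wedge z + P z) * P y - (wedge y + P y) * P z)
    (fun y y' z => by simp only [map_add, LinearMap.add_apply]; noncomm_ring)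
    (fun c y z => by
      simp only [map_smul, LinearMap.smul_apply, ← smul_add, smul_mul_assoc, mul_smul_comm,
        smul_sub])
    (fun y z z' => by simp only [map_add]; noncomm_ring)
    (fun c y z => by
      simp only [map_smul, ← smul_add, smul_mul_assoc, mul_smul_comm, smul_sub])

theorem correction_apply (C : V →ₗ[K] V →ₗ[K] Module.End K V)
    (P : V →ₗ[K] Module.End K (ExteriorAlgebra K V)) (y z : V) :
    correction C P y z = der (C y z) - (wedge z + P z) * P y - (wedge y + P y) * P z := rfl

/-- `P` is a deformation of exterior multiplication along `C`: it lowers the degree, is equivariant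
under the derivations `A` of `C`, and `y ∧ · + P y` satisfies a Clifford type relation with
right-hand side `der C(y, z)` (see `IsDeformation.anticomm`). -/
structure IsDeformation (C : V →ₗ[K] V →ₗ[K] Module.End K V)
    (P : V →ₗ[K] Module.End K (ExteriorAlgebra K V)) : Prop where
  lowers : ∀ y k, ∀ w ∈ degLT K V (k + 1), P y w ∈ degLT K V k
  equivariant : ∀ A : Module.End K V,
    (∀ y z, A * C y z - C y z * A = C (A y) z + C y (A z)) →
      ∀ y, der A * P y = P (A y) + P y * der A
  rel : ∀ y z, P y * wedge z + P z * wedge y = correction C P y z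

/-- The operators `P` with `P y ∘ (degree + 1) = polar (correction C P y)`, obtained as a fixed
point: the right-hand side in degree `k` only involves `P` in degrees less than `k`. -/
theorem exists_polar_fixedPoint [CharZero K] (C : V →ₗ[K] V →ₗ[K] Module.End K V) :
    ∃ P : V →ₗ[K] Module.End K (ExteriorAlgebra K V),
      (∀ y k, ∀ w ∈ degLT K V (k + 1), P y w ∈ degLT K V k) ∧
      (∀ A : Module.End K V, (∀ y z, A * C y z - C y z * A = C (A y) z + C y (A z)) →
        ∀ y, der A * P y = P (A y) + P y * der A) ∧
      ∀ y, P y * (scale fun i => ((i + 1 : ℕ) : K)) = polar (correction C P y) := by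
  refine Exists.elim (exists_fixedPoint_of_approx
    (T := V →ₗ[K] Module.End K (ExteriorAlgebra K V))
    (fun P => LinearMap.mulRight K (scale fun i => ((i + 1 : ℕ) : K)⁻¹) ∘ₗ
      (polarLin (K := K) (V := V) (W := ExteriorAlgebra K V)) ∘ₗ correction C P)
    (fun P => (∀ y k, ∀ w ∈ degLT K V (k + 1), P y w ∈ degLT K V k) ∧
      (∀ A : Module.End K V, (∀ y z, A * C y z - C y z * A = C (A y) z + C y (A z)) →
        ∀ y, der A * P y = P (A y) + P y * der A))
    (fun k P P' => ∀ y, ∀ w ∈ degLT K V k, P y w = P' y w) (finrank K V + 1) 0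
    ⟨fun _ _ _ _ => Submodule.zero_mem _, fun _ _ _ => by simp⟩ ?_ ?_ ?_ ?_) ?_
  · rintro P ⟨h1, h2⟩
    refine ⟨fun y k w hw => ?_, fun A hA y => ?_⟩
    · refine polar_mem (fun z v hv => ?_) (scale_mem _ hw)
      exact Submodule.sub_mem _ (Submodule.sub_mem _ (der_mem _ hv)
        (wedge_add_mem_of_lowers h1 y z hv)) (wedge_add_mem_of_lowers h1 z y hv)
    · have hR (z : V) : correction C P y z * der A =
          der A * correction C P y z - correction C P (A y) z - correction C P y (A z) := by
        have e1 := h2 A hA y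
        have e2 := h2 A hA z
        have e3 : der A * (wedge y + P y) = (wedge (A y) + P (A y)) + (wedge y + P y) * der A := by
          rw [mul_add, add_mul, der_mul_wedge, e1]; abel
        have e4 : der A * (wedge z + P z) = (wedge (A z) + P (A z)) + (wedge z + P z) * der A := by
          rw [mul_add, add_mul, der_mul_wedge, e2]; abel
        have e5 := der_lie (K := K) A (C y z)
        rw [hA, map_add] at e5
        exact commutator_correction_identity e5 e3 e4 e1 e2
      have h := polar_comp_der (correction C P y) A
      have e : (fun z => correction C P y z ∘ₗ der A) =
          fun z => der A ∘ₗ correction C P y z - correction C P (A y) z -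
            correction C P y (A z) := funext hR
      rw [e, polar_sub, polar_sub, comp_polar, sub_add_cancel] at h
      change polar (correction C P y) * der A =
        der A * polar (correction C P y) - polar (correction C P (A y)) at h
      change der A * (polar (correction C P y) * scale _) =
        polar (correction C P (A y)) * scale _ + polar (correction C P y) * scale _ * der A
      rw [mul_assoc _ (scale _), ← der_mul_scale, ← mul_assoc _ (der A), h, sub_mul, mul_assoc,
        add_sub_cancel]
  · intro P P' y w hw
    rw [degLT_zero, Submodule.mem_bot] at hw
    rw [hw, map_zero, map_zero]
  · rintro k P P' ⟨h1, _⟩ - h y w hw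
    refine polar_congr (fun z v hv => ?_) (scale_mem _ hw)
    have e (y z : V) : P z (P' y v) = P' z (P' y v) := by
      rw [← h y v hv, h z _ (lowers_mem_degLT h1 y hv)]
    simp only [correction_apply, LinearMap.sub_apply, Module.End.mul_apply, LinearMap.add_apply,
      h _ v hv, e]
  · intro P P' h
    refine LinearMap.ext fun y => LinearMap.ext fun w => h y w ?_
    rw [degLT_eq_top]
    trivial
  · rintro P ⟨⟨h1, h2⟩, h3⟩
    refine ⟨P, h1, h2, fun y => ?_⟩
    have h : polar (correction C P y) * (scale fun i => ((i + 1 : ℕ) : K)⁻¹) = P y :=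
      LinearMap.congr_fun h3 y
    rw [← h, mul_assoc, scale_mul]
    have : ((fun i => ((i + 1 : ℕ) : K)⁻¹) * fun i => ((i + 1 : ℕ) : K)) = 1 :=
      funext fun i => inv_mul_cancel₀ (Nat.cast_ne_zero.2 i.succ_ne_zero)
    rw [this, scale_one, mul_one]

/-- A symmetric `C` with values in its own derivations that satisfies the Jacobi identity admits a
deformation of the exterior multiplication. -/
theorem exists_isDeformation [CharZero K] (C : V →ₗ[K] V →ₗ[K] Module.End K V)
    (symm : ∀ y z, C y z = C z y)
    (jacobi : ∀ x y z, C y z x + C z x y + C x y z = 0)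
    (lie : ∀ a b y z, C a b * C y z - C y z * C a b = C (C a b y) z + C y (C a b z)) :
    ∃ P, IsDeformation C P := by
  obtain ⟨P, h1, h2, h3⟩ := exists_polar_fixedPoint C
  refine ⟨P, h1, h2, fun y z => ?_⟩
  have rsymm (y z : V) : correction C P y z = correction C P z y := by
    rw [correction_apply, correction_apply, symm]
    abel
  -- The obstruction to the relation satisfies a homogeneous equation in which the degree on the
  -- right-hand side is smaller.
  have obstr (y z : V) :
      (P y * wedge z + P z * wedge y - correction C P y z) * (scale fun i => ((i + 2 : ℕ) : K)) =
        -polar fun x =>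
          ((P y * wedge z + P z * wedge y - correction C P y z) * P x -
            (wedge x + P x) * (P y * wedge z + P z * wedge y - correction C P y z) +
          ((P z * wedge x + P x * wedge z - correction C P z x) * P y -
            (wedge y + P y) * (P z * wedge x + P x * wedge z - correction C P z x)) +
          ((P x * wedge y + P y * wedge x - correction C P x y) * P z -
            (wedge z + P z) * (P x * wedge y + P y * wedge x - correction C P x y))) := by
    -- The equation for `P` applies, as `(z ∧ ·) ∘ (degree + 2) = (degree + 1) ∘ (z ∧ ·)`.
    have first (y z : V) : P y * wedge z * (scale fun i => ((i + 2 : ℕ) : K)) =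
        correction C P y z - polar fun x => correction C P y x * wedge z := by
      have e := polar_comp_wedge (correction C P y) z
      have e' := scale_mul_wedge (fun i => ((i + 1 : ℕ) : K)) z
      rw [mul_assoc, ← e', ← mul_assoc, h3]
      exact e
    have second : correction C P y z * der 1 = polar fun x => correction C P y z * wedge x :=
      (comp_polar (correction C P y z) fun x => wedge x).symm
    have cyc (x : V) : correction C P y z * wedge x + correction C P z x * wedge y +
        correction C P x y * wedge z = _ :=
      cyclic_obstruction_identity (wedge_mul_wedge x y) (wedge_mul_wedge y z) (wedge_mul_wedge z x)
        (px := P x) (py := P y) (pz := P z)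
        (dyz := der (C y z)) (dzx := der (C z x)) (dxy := der (C x y)) (by
          have e (a b c : V) : der (C a b) * (wedge c + P c) - (wedge c + P c) * der (C a b) =
              wedge (C a b c) + P (C a b c) := by
            have e1 := h2 (C a b) (lie a b) c
            have e2 := der_mul_wedge (C a b) c
            linear_combination (norm := noncomm_ring) e1 + e2
          have j1 := congrArg (wedge (K := K)) (jacobi x y z)
          have j2 := congrArg P (jacobi x y z)
          rw [map_add, map_add, map_zero] at j1 j2
          rw [e, e, e]
          linear_combination (norm := abel) j1 + j2)
    have cyc' := congrArg polar (funext cyc)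
    rw [polar_add, polar_add] at cyc'
    have s2 : (fun x => correction C P x y * wedge z) = fun x => correction C P y x * wedge z :=
      funext fun x => by rw [rsymm]
    rw [s2] at cyc'
    simp only [correction_apply] at cyc' first second ⊢
    rw [sub_mul, add_mul, first, first, scale_natCast_add, mul_add, second, ← cyc']
    have : C z y = C y z := symm z y
    rw [this, mul_smul_comm, mul_one, Nat.cast_ofNat, two_smul]
    abel
  have vanish (k : ℕ) : ∀ y z, ∀ w ∈ degLT K V k,
      (P y * wedge z + P z * wedge y - correction C P y z : Module.End K (ExteriorAlgebra K V)) w =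
        0 := by
    induction k with
    | zero =>
      intro y z w hw
      rw [degLT_zero, Submodule.mem_bot] at hw
      rw [hw, map_zero]
    | succ k ih =>
      intro y z w hw
      have e : (scale fun i => ((i + 2 : ℕ) : K)) ((scale fun i => ((i + 2 : ℕ) : K)⁻¹) w) = w := by
        rw [← Module.End.mul_apply, scale_mul]
        refine scale_eq_self (fun i _ => ?_) hw
        exact mul_inv_cancel₀ (Nat.cast_ne_zero.2 (i + 1).succ_ne_zero)
      rw [← e, ← Module.End.mul_apply, obstr, LinearMap.neg_apply, neg_eq_zero]
      refine polar_eq_zero (fun x v hv => ?_) (scale_mem _ hw)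
      have hx := lowers_mem_degLT h1 x hv
      have hy := lowers_mem_degLT h1 y hv
      have hz := lowers_mem_degLT h1 z hv
      rw [LinearMap.add_apply, LinearMap.add_apply, LinearMap.sub_apply, LinearMap.sub_apply,
        LinearMap.sub_apply, Module.End.mul_apply, Module.End.mul_apply, Module.End.mul_apply,
        Module.End.mul_apply, Module.End.mul_apply, Module.End.mul_apply, ih _ _ _ hx,
        ih _ _ _ hy, ih _ _ _ hz, ih _ _ _ hv, ih _ _ _ hv, ih _ _ _ hv]
      simp
  refine sub_eq_zero.1 (LinearMap.ext fun w => vanish (finrank K V + 1) y z w ?_)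
  rw [degLT_eq_top]
  trivial

/-- The deformed multiplications by odd vectors satisfy the relation of the Lie superbracket. -/
theorem IsDeformation.anticomm {C : V →ₗ[K] V →ₗ[K] Module.End K V}
    {P : V →ₗ[K] Module.End K (ExteriorAlgebra K V)} (h : IsDeformation C P) (y z : V) :
    (wedge y + P y) * (wedge z + P z) + (wedge z + P z) * (wedge y + P y) = der (C y z) := by
  have h1 := h.rel y z
  have h2 := wedge_mul_wedge (K := K) y z
  rw [correction_apply] at h1
  linear_combination (norm := noncomm_ring) h1 + h2

end ExteriorAlgebra

namespace ExteriorAlgebra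

open Module (finBasis finrank)

variable {K V : Type*} [Field K] [AddCommGroup V] [Module K V] [FiniteDimensional K V]

/-! ### The universal property of the deformed exterior algebra -/

section Universal

variable {W : Type*} [AddCommGroup W] [Module K W]

/-- The family of operators `z ↦ b z ∘ s - s ∘ P z`. -/
noncomputable def defect (P : V →ₗ[K] Module.End K (ExteriorAlgebra K V))
    (b : V →ₗ[K] Module.End K W) (s : ExteriorAlgebra K V →ₗ[K] W) :
    V →ₗ[K] ExteriorAlgebra K V →ₗ[K] W where
  toFun z := b z ∘ₗ s - s ∘ₗ P z
  map_add' y z := by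
    rw [map_add, map_add, LinearMap.add_comp, LinearMap.comp_add]
    abel
  map_smul' c y := by
    rw [map_smul, map_smul, LinearMap.smul_comp, LinearMap.comp_smul, RingHom.id_apply, smul_sub]

omit [FiniteDimensional K V] in
theorem defect_apply (P : V →ₗ[K] Module.End K (ExteriorAlgebra K V))
    (b : V →ₗ[K] Module.End K W) (s : ExteriorAlgebra K V →ₗ[K] W) (z : V)
    (w : ExteriorAlgebra K V) : defect P b s z w = b z (s w) - s (P z w) := rfl

theorem algebraMapInv_der (A : Module.End K V) (w : ExteriorAlgebra K V) :
    algebraMapInv (der A w) = 0 := by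
  simp [der_apply_eq, polar_apply, wedge_apply, algebraMapInv]

/-- A solution of `s ∘ degree = polar (defect P b s)` with prescribed value at `1`, obtained as a
fixed point. It intertwines `der A` and `a` whenever the data do. -/
theorem exists_defect_fixedPoint [CharZero K] {C : V →ₗ[K] V →ₗ[K] Module.End K V}
    {P : V →ₗ[K] Module.End K (ExteriorAlgebra K V)} (hP : IsDeformation C P)
    (b : V →ₗ[K] Module.End K W) (v : W) :
    ∃ s : ExteriorAlgebra K V →ₗ[K] W, s 1 = v ∧ s ∘ₗ der 1 = polar (defect P b s) ∧
      ∀ (A : Module.End K V) (a : Module.End K W),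
        (∀ y z, A * C y z - C y z * A = C (A y) z + C y (A z)) →
        (∀ y, a * b y = b (A y) + b y * a) → a v = 0 → s ∘ₗ der A = a ∘ₗ s := by
  have key := exists_fixedPoint_of_approx (T := ExteriorAlgebra K V →ₗ[K] W)
    (fun s => (algebraMapInv (R := K) (M := V)).toLinearMap.smulRight v +
      polar (defect P b s) ∘ₗ scale fun i => (i : K)⁻¹)
    (fun s => ∀ (A : Module.End K V) (a : Module.End K W),
      (∀ y z, A * C y z - C y z * A = C (A y) z + C y (A z)) →
      (∀ y, a * b y = b (A y) + b y * a) → a v = 0 → s ∘ₗ der A = a ∘ₗ s)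
    (fun k s s' => ∀ w ∈ degLT K V k, s w = s' w) (finrank K V + 1) 0
    (fun _ _ _ _ _ => by rw [LinearMap.zero_comp, LinearMap.comp_zero]) ?_ ?_ ?_ ?_
  · obtain ⟨s, h1, h2⟩ := key
    have h0 (w : ExteriorAlgebra K V) :
        s w = algebraMapInv w • v + polar (defect P b s) (scale (fun i => (i : K)⁻¹) w) :=
      (LinearMap.congr_fun h2 w).symm
    refine ⟨s, ?_, ?_, h1⟩
    · have e : (1 : ExteriorAlgebra K V) ∈ ⋀[K]^0 V := by
        rw [exteriorPower, pow_zero]; exact Submodule.mem_one.2 ⟨1, map_one _⟩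
      rw [h0, scale_of_mem _ e, map_smul, polar_one, smul_zero, map_one, one_smul, add_zero]
    · refine linearMap_ext_degree fun i w hw => ?_
      rw [LinearMap.comp_apply, h0, algebraMapInv_der, zero_smul, zero_add, der_id,
        scale_of_mem _ hw, map_smul, scale_of_mem _ hw, smul_smul]
      rcases eq_or_ne i 0 with rfl | hi
      · simp [polar_apply, contr_eq_zero _ hw]
      · rw [mul_inv_cancel₀ (Nat.cast_ne_zero.2 hi), one_smul]
  · intro s hs A a hA hb hv
    have hT (z : V) : defect P b s z ∘ₗ der A = a ∘ₗ defect P b s z - defect P b s (A z) := by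
      refine LinearMap.ext fun w => ?_
      have e1 := LinearMap.congr_fun (hs A a hA hb hv) w
      have e2 := LinearMap.congr_fun (hs A a hA hb hv) (P z w)
      have e3 := LinearMap.congr_fun (hb z) (s w)
      have e4 := congrArg s (LinearMap.congr_fun (hP.equivariant A hA z) w)
      simp only [LinearMap.comp_apply, LinearMap.sub_apply, LinearMap.add_apply,
        Module.End.mul_apply, defect_apply, map_add, map_sub] at e1 e2 e3 e4 ⊢
      rw [e1]
      linear_combination (norm := abel) -e3 - e2 + e4
    have h := polar_comp_der (defect P b s) A
    rw [funext hT, polar_sub, sub_add_cancel, comp_polar] at h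
    refine LinearMap.ext fun w => ?_
    have e := LinearMap.congr_fun (der_mul_scale (fun i => (i : K)⁻¹) A) w
    have h' := LinearMap.congr_fun h (scale (fun i => (i : K)⁻¹) w)
    simp only [LinearMap.comp_apply, LinearMap.add_apply, Module.End.mul_apply,
      LinearMap.smulRight_apply, AlgHom.toLinearMap_apply, map_add, map_smul] at h' e ⊢
    rw [algebraMapInv_der, hv, ← h', e, zero_smul, smul_zero]
  · intro s s' w hw
    rw [degLT_zero, Submodule.mem_bot] at hw
    rw [hw, map_zero, map_zero]
  · intro k s s' _ _ h w hw
    simp only [LinearMap.add_apply, LinearMap.comp_apply]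
    congr 1
    refine polar_congr (fun z u hu => ?_) (scale_mem _ hw)
    rw [defect_apply, defect_apply, h u hu, h _ (lowers_mem_degLT hP.lowers z hu)]
  · intro s s' h
    refine LinearMap.ext fun w => h w ?_
    rw [degLT_eq_top]
    trivial

/-- Existence in the universal property of the deformed exterior algebra: a vector `v` annihilated
by the operators `a X` is the image of `1` under a linear map that intertwines the operators
`y ∧ · + P y` with `b y` and `der (ad X)` with `a X`. -/
theorem IsDeformation.exists_intertwining [CharZero K]
    {C : V →ₗ[K] V →ₗ[K] Module.End K V} {P : V →ₗ[K] Module.End K (ExteriorAlgebra K V)}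
    (hP : IsDeformation C P) {S : Type*} {ad : S → Module.End K V} {br : V → V → S}
    (hC : ∀ y z, C y z = ad (br y z))
    (had : ∀ X y z, ad X * C y z - C y z * ad X = C (ad X y) z + C y (ad X z))
    {a : S → Module.End K W} {b : V →ₗ[K] Module.End K W}
    (hab : ∀ X y, a X * b y = b (ad X y) + b y * a X)
    (hbb : ∀ y z, b y * b z + b z * b y = a (br y z)) {v : W} (hv : ∀ X, a X v = 0) :
    ∃ s : ExteriorAlgebra K V →ₗ[K] W, s 1 = v ∧
      (∀ X w, s (der (ad X) w) = a X (s w)) ∧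
      ∀ y w, s (wedge y w + P y w) = b y (s w) := by
  obtain ⟨s, h1, h2, h3⟩ := exists_defect_fixedPoint hP b v
  have hs (X : S) (w : ExteriorAlgebra K V) : s (der (ad X) w) = a X (s w) :=
    LinearMap.congr_fun (h3 (ad X) (a X) (had X) (hab X) (hv X)) w
  refine ⟨s, h1, hs, ?_⟩
  -- `E y` is the obstruction to the last claim. It satisfies a homogeneous equation in which the
  -- degree on the right-hand side is smaller.
  let E (y : V) : ExteriorAlgebra K V →ₗ[K] W := s ∘ₗ (wedge y + P y) - b y ∘ₗ s
  have hE (y : V) (w : ExteriorAlgebra K V) :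
      E y w = s (wedge y w) + s (P y w) - b y (s w) := by
    simp [E]
  have obstr (y : V) (w : ExteriorAlgebra K V) : E y (der 1 w + w) =
      -polar (fun z => b z ∘ₗ E y + E z ∘ₗ P y + E y ∘ₗ P z) w := by
    have step (z : V) : defect P b s z ∘ₗ wedge y =
        (b z ∘ₗ E y + E z ∘ₗ P y + E y ∘ₗ P z) - b y ∘ₗ defect P b s z +
          (s ∘ₗ P y) ∘ₗ wedge z := by
      refine LinearMap.ext fun w => ?_
      have e1 := congrArg s (LinearMap.congr_fun (hP.rel y z) w)
      have e2 := LinearMap.congr_fun (hbb y z) (s w)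
      rw [correction_apply, hC] at e1
      simp only [LinearMap.comp_apply, LinearMap.sub_apply, LinearMap.add_apply,
        Module.End.mul_apply, defect_apply, map_add, map_sub, hE, hs] at e1 e2 ⊢
      linear_combination (norm := abel) -e1 + e2
    have h := LinearMap.congr_fun (polar_comp_wedge (defect P b s) y) w
    rw [funext step, polar_add, polar_sub, comp_polar, comp_polar, ← h2] at h
    have hd := LinearMap.congr_fun (der_mul_wedge (1 : Module.End K V) y) w
    simp only [LinearMap.comp_apply, LinearMap.sub_apply, LinearMap.add_apply,
      Module.End.mul_apply, defect_apply, Module.End.one_apply] at h hd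
    have hpol : polar wedge w = der 1 w := rfl
    rw [hd, hpol] at h
    simp only [map_add, hE] at h ⊢
    linear_combination (norm := abel) h
  have vanish (k : ℕ) : ∀ y, ∀ w ∈ degLT K V k, E y w = 0 := by
    induction k with
    | zero =>
      intro y w hw
      rw [degLT_zero, Submodule.mem_bot] at hw
      rw [hw, map_zero]
    | succ k ih =>
      intro y w hw
      have e : der 1 ((scale fun i => ((i + 1 : ℕ) : K)⁻¹) w) +
          (scale fun i => ((i + 1 : ℕ) : K)⁻¹) w = w := by
        have e1 := LinearMap.congr_fun (scale_natCast_add (K := K) (V := V) 1)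
          ((scale fun i => ((i + 1 : ℕ) : K)⁻¹) w)
        rw [← Module.End.mul_apply, scale_mul, scale_eq_self (fun i _ => ?_) hw] at e1
        · rw [Nat.cast_one, one_smul] at e1
          exact e1.symm
        · exact mul_inv_cancel₀ (Nat.cast_ne_zero.2 i.succ_ne_zero)
      rw [← e, obstr, neg_eq_zero]
      refine polar_eq_zero (fun z u hu => ?_) (scale_mem _ hw)
      simp only [LinearMap.add_apply, LinearMap.comp_apply, ih y u hu,
        ih _ _ (lowers_mem_degLT hP.lowers _ hu), map_zero, add_zero]
  intro y w
  have h := vanish (finrank K V + 1) y w (by rw [degLT_eq_top]; trivial)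
  rw [hE, ← map_add] at h
  exact sub_eq_zero.1 h

end Universal

/-- The deformed exterior algebra is generated by `1`. -/
theorem IsDeformation.eq_top_of_stable
    {C : V →ₗ[K] V →ₗ[K] Module.End K V} {P : V →ₗ[K] Module.End K (ExteriorAlgebra K V)}
    (hP : IsDeformation C P) {p : Submodule K (ExteriorAlgebra K V)} (h1 : 1 ∈ p)
    (hp : ∀ y, ∀ w ∈ p, wedge y w + P y w ∈ p) : p = ⊤ := by
  have key (k : ℕ) : degLT K V k ≤ p := by
    induction k with
    | zero => rw [degLT_zero]; exact bot_le
    | succ k ih =>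
      refine degLT_le.2 fun i hi => ?_
      cases i with
      | zero =>
        intro w hw
        obtain ⟨c, rfl⟩ := mem_exteriorPower_zero hw
        exact Submodule.smul_mem _ _ h1
      | succ i =>
        refine exteriorPower_succ_induction fun y w hw => ?_
        have hw' : w ∈ degLT K V k := exteriorPower_le_degLT (by omega) hw
        have := Submodule.sub_mem _ (hp y w (ih hw')) (ih (lowers_mem_degLT hP.lowers y hw'))
        rwa [add_sub_cancel_right] at this
  rw [← top_le_iff, ← degLT_eq_top]
  exact key _


/-! ### The top degree -/

/-- An element of degree at most `k`, where `k` is not the top degree, whose products by the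
deformed multiplications also have degree at most `k`, has degree less than `k`. -/
theorem mem_degLT_of_wedge_add_mem [CharZero K] {P : V →ₗ[K] Module.End K (ExteriorAlgebra K V)}
    (hP : ∀ y k, ∀ w ∈ degLT K V (k + 1), P y w ∈ degLT K V k) {k : ℕ} (hk : k < finrank K V)
    {w : ExteriorAlgebra K V} (hw : w ∈ degLT K V (k + 1))
    (h : ∀ y, wedge y w + P y w ∈ degLT K V (k + 1)) : w ∈ degLT K V k := by
  have h1 : (finrank K V : K) • w - der 1 w ∈ degLT K V k := by
    rw [← sum_contr_wedge]
    refine Submodule.sum_mem _ fun j _ => contr_mem _ ?_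
    have := Submodule.sub_mem _ (h (finBasis K V j)) (lowers_mem_degLT hP (finBasis K V j) hw)
    rwa [add_sub_cancel_right] at this
  have h2 : scale (fun i => ((finrank K V : K) - i)) w = (finrank K V : K) • w - der 1 w := by
    rw [der_id]
    have e : scale (fun i => ((finrank K V : K) - i)) =
        (finrank K V : K) • (1 : Module.End K (ExteriorAlgebra K V)) - scale fun i => (i : K) :=
      linearMap_ext_degree fun i w hw => by
        rw [scale_of_mem _ hw, LinearMap.sub_apply, scale_of_mem _ hw, sub_smul]
        rfl
    rw [e]
    rfl
  have h3 : scale (fun i => ((finrank K V : K) - i)⁻¹)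
      (scale (fun i => ((finrank K V : K) - i)) w) = w := by
    rw [← Module.End.mul_apply, scale_mul]
    refine scale_eq_self (fun i hi => inv_mul_cancel₀ ?_) hw
    rw [sub_ne_zero, Nat.cast_inj.ne]
    omega
  rw [← h3, h2]
  exact scale_mem _ h1

/-- The deformed exterior algebra has no nonzero stable subspace below the top degree. -/
theorem eq_bot_of_stable [CharZero K] {P : V →ₗ[K] Module.End K (ExteriorAlgebra K V)}
    (hP : ∀ y k, ∀ w ∈ degLT K V (k + 1), P y w ∈ degLT K V k)
    {p : Submodule K (ExteriorAlgebra K V)} (hp : ∀ y, ∀ w ∈ p, wedge y w + P y w ∈ p)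
    (htop : p ≤ degLT K V (finrank K V)) : p = ⊥ := by
  have key (j : ℕ) : p ≤ degLT K V (finrank K V - j) := by
    induction j with
    | zero => exact htop
    | succ j ih =>
      rcases Nat.lt_or_ge j (finrank K V) with hj | hj
      · have e : finrank K V - j = (finrank K V - (j + 1)) + 1 := by omega
        rw [e] at ih
        exact fun w hw => mem_degLT_of_wedge_add_mem hP (by omega) (ih hw)
          fun y => ih (hp y w hw)
      · have e : finrank K V - (j + 1) = finrank K V - j := by omega
        rwa [e]
  have := key (finrank K V)
  rwa [Nat.sub_self, degLT_zero, le_bot_iff] at this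

/-- A linear form on the exterior algebra whose kernel is the part below the top degree. The
derivations act on it by their trace. -/
theorem exists_top_form (K V : Type*) [Field K] [AddCommGroup V] [Module K V]
    [FiniteDimensional K V] :
    ∃ t : ExteriorAlgebra K V →ₗ[K] K, (∀ w, t w = 0 ↔ w ∈ degLT K V (finrank K V)) ∧
      ∀ A w, t (der A w) = LinearMap.trace K V A * t w := by
  classical
  let p : Module.End K (ExteriorAlgebra K V) := scale fun i => if i = finrank K V then 1 else 0
  have hp_ne {i : ℕ} (hi : i ≠ finrank K V) {w} (hw : w ∈ ⋀[K]^i V) : p w = 0 := by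
    simp only [p]
    rw [scale_of_mem _ hw, if_neg hi, zero_smul]
  have hp_eq {w} (hw : w ∈ ⋀[K]^(finrank K V) V) : p w = w := by
    simp only [p]
    rw [scale_of_mem _ hw, if_pos rfl, one_smul]
  have htop : ∀ w, w ∈ degLT K V (finrank K V + 1) := fun w => by rw [degLT_eq_top]; trivial
  have hp_mem (w) : p w ∈ ⋀[K]^(finrank K V) V := by
    refine degLT_le (p := (⋀[K]^(finrank K V) V).comap p) |>.2 (fun i hi w hw => ?_) (htop w)
    rw [Submodule.mem_comap]
    rcases eq_or_ne i (finrank K V) with rfl | h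
    · rwa [hp_eq hw]
    · rw [hp_ne h hw]; exact Submodule.zero_mem _
  have hp_sub (w) : w - p w ∈ degLT K V (finrank K V) := by
    refine degLT_le (p := (degLT K V (finrank K V)).comap (LinearMap.id - p)) |>.2
      (fun i hi w hw => ?_) (htop w)
    rw [Submodule.mem_comap, LinearMap.sub_apply, LinearMap.id_apply]
    rcases eq_or_ne i (finrank K V) with rfl | h
    · rw [hp_eq hw, sub_self]; exact Submodule.zero_mem _
    · rw [hp_ne h hw, sub_zero]; exact exteriorPower_le_degLT (by omega) hw
  have hp_ker {w} (hw : w ∈ degLT K V (finrank K V)) : p w = 0 := by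
    refine degLT_le (p := LinearMap.ker p) |>.2 (fun i hi w hw => ?_) hw
    exact hp_ne hi.ne hw
  have hdim : finrank K (⋀[K]^(finrank K V) V) = finrank K K := by
    rw [exteriorPower.finrank_eq, Nat.choose_self, Module.finrank_self]
  let e := LinearEquiv.ofFinrankEq _ _ hdim
  refine ⟨e.toLinearMap ∘ₗ p.codRestrict _ hp_mem, fun w => ?_, fun A w => ?_⟩
  · rw [LinearMap.comp_apply, LinearEquiv.coe_coe, LinearEquiv.map_eq_zero_iff, ← Subtype.coe_inj,
      LinearMap.codRestrict_apply, ZeroMemClass.coe_zero]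
    refine ⟨fun h => ?_, hp_ker⟩
    have := hp_sub w
    rwa [h, sub_zero] at this
  · have h1 : p (der A w) = LinearMap.trace K V A • p w := by
      rw [← der_eq_trace_smul]
      · exact LinearMap.congr_fun (der_mul_scale _ A).symm w
      · intro y
        have := wedge_mem_exteriorPower y (hp_mem w)
        rwa [exteriorPower_eq_bot (Nat.lt_succ_self _), Submodule.mem_bot] at this
    have h2 : p.codRestrict _ hp_mem (der A w) =
        LinearMap.trace K V A • p.codRestrict _ hp_mem w := Subtype.ext h1
    rw [LinearMap.comp_apply, h2, map_smul]
    rfl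

end ExteriorAlgebra

namespace LieSuperalgebra

open ExteriorAlgebra

variable {K : Type*} [Field K] {L : Type*} [AddCommGroup L] [Module K L]

/-! ### The even and odd brackets -/

/-- The symmetric bracket of two odd elements, as an even element. -/
noncomputable def oddBracket (g : LieSuperalgebra K L) : g.odd →ₗ[K] g.odd →ₗ[K] g.even :=
  LinearMap.mk₂ K (fun y z => ⟨g.bracket y z, g.bracket_mem y.2 z.2⟩)
    (fun _ _ _ => Subtype.ext (by simp)) (fun _ _ _ => Subtype.ext (by simp))
    (fun _ _ _ => Subtype.ext (by simp)) (fun _ _ _ => Subtype.ext (by simp))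

theorem coe_oddBracket (g : LieSuperalgebra K L) (y z : g.odd) :
    (g.oddBracket y z : L) = g.bracket y z := rfl

theorem coe_adOdd (g : LieSuperalgebra K L) (X : g.even) (y : g.odd) :
    (g.adOdd X y : L) = g.bracket X y := rfl

/-- The bracket of two even elements. -/
def evenBracket (g : LieSuperalgebra K L) (X Y : g.even) : g.even :=
  ⟨g.bracket X Y, by have h := g.bracket_mem X.2 Y.2; rwa [zero_add] at h⟩

theorem oddBracket_comm (g : LieSuperalgebra K L) (y z : g.odd) :
    g.oddBracket y z = g.oddBracket z y := by
  have h := g.bracket_skew y.2 z.2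
  rw [ZMod.val_one] at h
  refine Subtype.ext ?_
  simpa [coe_oddBracket] using h

theorem bracket_odd_even (g : LieSuperalgebra K L) (y : g.odd) (X : g.even) :
    g.bracket y X = -g.adOdd X y := by
  have h := g.bracket_skew y.2 X.2
  rw [ZMod.val_zero, mul_zero, pow_zero, one_smul] at h
  exact h

theorem adOdd_evenBracket (g : LieSuperalgebra K L) (X Y : g.even) :
    g.adOdd (g.evenBracket X Y) = g.adOdd X * g.adOdd Y - g.adOdd Y * g.adOdd X := by
  refine LinearMap.ext fun y => Subtype.ext ?_
  have h := g.jacobi X.2 Y.2 (y : L)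
  rw [ZMod.val_zero, zero_mul, pow_zero, one_smul] at h
  exact eq_sub_of_add_eq h.symm

theorem evenBracket_oddBracket (g : LieSuperalgebra K L) (X : g.even) (y z : g.odd) :
    g.evenBracket X (g.oddBracket y z) =
      g.oddBracket (g.adOdd X y) z + g.oddBracket y (g.adOdd X z) := by
  refine Subtype.ext ?_
  have h := g.jacobi X.2 y.2 (z : L)
  rw [ZMod.val_zero, zero_mul, pow_zero, one_smul] at h
  exact h

/-- The operator on the odd part given by the bracket of two odd elements. -/
noncomputable def oddCurvature (g : LieSuperalgebra K L) :
    g.odd →ₗ[K] g.odd →ₗ[K] Module.End K g.odd :=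
  g.oddBracket.compr₂ g.adOdd

theorem oddCurvature_apply (g : LieSuperalgebra K L) (y z : g.odd) :
    g.oddCurvature y z = g.adOdd (g.oddBracket y z) := rfl

theorem oddCurvature_jacobi (g : LieSuperalgebra K L) (x y z : g.odd) :
    g.oddCurvature y z x + g.oddCurvature z x y + g.oddCurvature x y z = 0 := by
  refine Subtype.ext ?_
  have h := g.jacobi x.2 y.2 (z : L)
  rw [ZMod.val_one, mul_one, pow_one, neg_one_smul, ← coe_oddBracket, ← coe_oddBracket,
    ← coe_oddBracket, bracket_odd_even, bracket_odd_even, ← coe_adOdd, oddBracket_comm g x z] at h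
  simp only [Submodule.coe_add, oddCurvature_apply, ZeroMemClass.coe_zero]
  linear_combination (norm := abel) -h

theorem adOdd_oddCurvature (g : LieSuperalgebra K L) (X : g.even) (y z : g.odd) :
    g.adOdd X * g.oddCurvature y z - g.oddCurvature y z * g.adOdd X =
      g.oddCurvature (g.adOdd X y) z + g.oddCurvature y (g.adOdd X z) := by
  simp only [oddCurvature_apply]
  rw [← adOdd_evenBracket, evenBracket_oddBracket, map_add]

/-! ### Modules over the enveloping algebra -/

theorem toEnveloping_rel (g : LieSuperalgebra K L) {i j : ZMod 2} {x y : L}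
    (hx : x ∈ g.grading i) (hy : y ∈ g.grading j) :
    g.toEnveloping x * g.toEnveloping y -
        (-1 : K) ^ (i.val * j.val) • (g.toEnveloping y * g.toEnveloping x) =
      g.toEnveloping (g.bracket x y) := by
  have h := RingQuot.mkAlgHom_rel K (EnvelopingRel.of hx hy)
  rw [map_sub, map_smul, map_mul, map_mul] at h
  exact h

theorem toEnveloping_even_odd (g : LieSuperalgebra K L) (X : g.even) (y : g.odd) :
    g.toEnveloping X * g.toEnveloping y =
      g.toEnveloping (g.adOdd X y) + g.toEnveloping y * g.toEnveloping X := by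
  have h := g.toEnveloping_rel X.2 y.2
  rw [ZMod.val_zero, zero_mul, pow_zero, one_smul] at h
  exact eq_add_of_sub_eq h

theorem toEnveloping_odd_odd (g : LieSuperalgebra K L) (y z : g.odd) :
    g.toEnveloping y * g.toEnveloping z + g.toEnveloping z * g.toEnveloping y =
      g.toEnveloping (g.oddBracket y z) := by
  have h := g.toEnveloping_rel y.2 z.2
  rw [ZMod.val_one, mul_one, pow_one, neg_one_smul, sub_neg_eq_add] at h
  exact h

/-- Induction on the enveloping algebra: it is generated by the even and the odd elements. -/
theorem enveloping_induction (g : LieSuperalgebra K L) {p : g.Enveloping → Prop}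
    (algebraMap : ∀ c : K, p (algebraMap K g.Enveloping c))
    (even : ∀ X : g.even, p (g.toEnveloping X)) (odd : ∀ y : g.odd, p (g.toEnveloping y))
    (mul : ∀ u v, p u → p v → p (u * v)) (add : ∀ u v, p u → p v → p (u + v))
    (u : g.Enveloping) : p u := by
  obtain ⟨u, rfl⟩ := RingQuot.mkAlgHom_surjective K g.EnvelopingRel u
  induction u using TensorAlgebra.induction with
  | algebraMap r => rw [AlgHom.commutes]; exact algebraMap r
  | ι x =>
    obtain ⟨a, ha, b, hb, rfl⟩ : ∃ a ∈ g.grading 0, ∃ b ∈ g.grading 1, a + b = x :=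
      Submodule.mem_sup.1 (g.isCompl.sup_eq_top ▸ Submodule.mem_top)
    rw [map_add, map_add]
    exact add _ _ (even ⟨a, ha⟩) (odd ⟨b, hb⟩)
  | mul a b ha hb => rw [map_mul]; exact mul _ _ ha hb
  | add a b ha hb => rw [map_add]; exact add _ _ ha hb

/-- Operators for the even and for the odd elements that satisfy the relations of the Lie
superalgebra define a module over the enveloping algebra. -/
theorem exists_enveloping_lift (g : LieSuperalgebra K L) {A : Type*} [Ring A] [Algebra K A]
    (a : g.even →ₗ[K] A) (b : g.odd →ₗ[K] A)
    (haa : ∀ X Y, a X * a Y - a Y * a X = a (g.evenBracket X Y))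
    (hab : ∀ X y, a X * b y = b (g.adOdd X y) + b y * a X)
    (hbb : ∀ y z, b y * b z + b z * b y = a (g.oddBracket y z)) :
    ∃ ρ : g.Enveloping →ₐ[K] A, (∀ X : g.even, ρ (g.toEnveloping X) = a X) ∧
      ∀ y : g.odd, ρ (g.toEnveloping y) = b y := by
  let r : L →ₗ[K] A := LinearMap.ofIsCompl g.isCompl a b
  have r0 (X : g.even) : r X = a X := LinearMap.ofIsCompl_apply_left g.isCompl X
  have r1 (y : g.odd) : r y = b y := LinearMap.ofIsCompl_apply_right g.isCompl y
  have hr {i j : ZMod 2} {x y : L} (hx : x ∈ g.grading i) (hy : y ∈ g.grading j) :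
      r x * r y - (-1 : K) ^ (i.val * j.val) • (r y * r x) = r (g.bracket x y) := by
    have h01 (i : ZMod 2) : i = 0 ∨ i = 1 := by decide +revert
    rcases h01 i with rfl | rfl <;> rcases h01 j with rfl | rfl
    · have := haa ⟨x, hx⟩ ⟨y, hy⟩
      rw [← r0, ← r0, ← r0] at this
      rw [ZMod.val_zero, zero_mul, pow_zero, one_smul]
      exact this
    · have := hab ⟨x, hx⟩ ⟨y, hy⟩
      rw [← r0, ← r1, ← r1] at this
      rw [ZMod.val_zero, zero_mul, pow_zero, one_smul]
      exact sub_eq_of_eq_add this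
    · have := hab ⟨y, hy⟩ ⟨x, hx⟩
      have e := g.bracket_odd_even ⟨x, hx⟩ ⟨y, hy⟩
      rw [← r0, ← r1, ← r1] at this
      rw [ZMod.val_zero, mul_zero, pow_zero, one_smul]
      refine Eq.trans ?_ (congrArg r e).symm
      rw [map_neg]
      linear_combination (norm := abel) -this
    · have := hbb ⟨x, hx⟩ ⟨y, hy⟩
      rw [← r0, ← r1, ← r1] at this
      rw [ZMod.val_one, mul_one, pow_one, neg_one_smul, sub_neg_eq_add]
      exact this
  have ht : ∀ ⦃x y : TensorAlgebra K L⦄, g.EnvelopingRel x y →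
      TensorAlgebra.lift K r x = TensorAlgebra.lift K r y := by
    rintro _ _ ⟨hx, hy⟩
    simp only [map_sub, map_smul, map_mul, TensorAlgebra.lift_ι_apply]
    exact hr hx hy
  have key (x : L) : RingQuot.liftAlgHom K ⟨TensorAlgebra.lift K r, ht⟩ (g.toEnveloping x) = r x :=
    (RingQuot.liftAlgHom_mkAlgHom_apply (S := K) _ _ _).trans (TensorAlgebra.lift_ι_apply _ _)
  exact ⟨RingQuot.liftAlgHom K ⟨TensorAlgebra.lift K r, ht⟩, fun X => (key X).trans (r0 X),
    fun y => (key y).trans (r1 y)⟩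

theorem mem_invariants_iff (g : LieSuperalgebra K L) {M : Type*} [AddCommGroup M] [Module K M]
    [Module g.Enveloping M] [IsScalarTower K g.Enveloping M] {m : M} :
    m ∈ g.invariants M ↔ (∀ X : g.even, g.toEnveloping X • m = 0) ∧
      ∀ y : g.odd, g.toEnveloping y • m = 0 := by
  have h0 (x : L) (h : m ∈ g.invariants M) : g.toEnveloping x • m = 0 :=
    (h _).trans (by rw [counit_toEnveloping, zero_smul])
  refine ⟨fun h => ⟨fun X => h0 X h, fun y => h0 y h⟩, fun ⟨he, ho⟩ u => ?_⟩
  induction u using g.enveloping_induction with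
  | algebraMap c => rw [algebraMap_smul, AlgHom.commutes, Algebra.algebraMap_self_apply]
  | even X => rw [he, counit_toEnveloping, zero_smul]
  | odd y => rw [ho, counit_toEnveloping, zero_smul]
  | mul u v hu hv =>
    rw [mul_smul, hv, map_mul, mul_comm, mul_smul, ← hu, ← algebraMap_smul g.Enveloping, smul_smul,
      ← Algebra.commutes, ← smul_smul, algebraMap_smul]
  | add u v hu hv => rw [add_smul, hu, hv, map_add, add_smul]

variable [FiniteDimensional K L]

theorem exists_isDeformation_oddCurvature [CharZero K] (g : LieSuperalgebra K L) :
    ∃ P, IsDeformation g.oddCurvature P :=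
  exists_isDeformation _
    (fun y z => by rw [oddCurvature_apply, oddCurvature_apply, oddBracket_comm])
    g.oddCurvature_jacobi
    fun a b y z => g.adOdd_oddCurvature (g.oddBracket a b) y z

/-- The deformed exterior algebra as a module over the enveloping algebra. -/
theorem exists_enveloping_lift_exteriorAlgebra (g : LieSuperalgebra K L)
    {P : g.odd →ₗ[K] Module.End K (ExteriorAlgebra K g.odd)}
    (hP : IsDeformation g.oddCurvature P) :
    ∃ ρ : g.Enveloping →ₐ[K] Module.End K (ExteriorAlgebra K g.odd),
      (∀ X : g.even, ρ (g.toEnveloping X) = der (g.adOdd X)) ∧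
      ∀ y : g.odd, ρ (g.toEnveloping y) = wedge y + P y := by
  have haa (X Y : g.even) : der (g.adOdd X) * der (g.adOdd Y) - der (g.adOdd Y) * der (g.adOdd X) =
      (der (g.adOdd (g.evenBracket X Y)) : Module.End K (ExteriorAlgebra K g.odd)) := by
    rw [adOdd_evenBracket, der_lie]
  have hab (X : g.even) (y : g.odd) : der (g.adOdd X) * (wedge y + P y) =
      (wedge (g.adOdd X y) + P (g.adOdd X y)) + (wedge y + P y) * der (g.adOdd X) := by
    have h := hP.equivariant (g.adOdd X) (g.adOdd_oddCurvature X) y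
    rw [mul_add, add_mul, der_mul_wedge, h]
    abel
  exact g.exists_enveloping_lift (der ∘ₗ g.adOdd) (wedge + P) haa hab hP.anticomm

/-- The module `U(g) / U(g) g₀` is the exterior algebra of the odd part, on which the odd elements
act by a deformation of the exterior multiplication and the even ones by derivations. -/
theorem exists_equiv_exteriorAlgebra [CharZero K] (g : LieSuperalgebra K L)
    {P : g.odd →ₗ[K] Module.End K (ExteriorAlgebra K g.odd)}
    (hP : IsDeformation g.oddCurvature P) :
    ∃ s : ExteriorAlgebra K g.odd ≃ₗ[K] (g.Enveloping ⧸ g.evenIdeal),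
      (∀ X w, s (der (g.adOdd X) w) = g.toEnveloping X • s w) ∧
      ∀ y w, s (wedge y w + P y w) = g.toEnveloping y • s w := by
  obtain ⟨ρ, hρ0, hρ1⟩ := g.exists_enveloping_lift_exteriorAlgebra hP
  let a : L →ₗ[K] Module.End K (g.Enveloping ⧸ g.evenIdeal) :=
    (Algebra.lsmul K K (g.Enveloping ⧸ g.evenIdeal)).toLinearMap ∘ₗ g.toEnveloping
  have ha (x : L) (m : g.Enveloping ⧸ g.evenIdeal) : a x m = g.toEnveloping x • m := rfl
  obtain ⟨s, h1, hs0, hs1⟩ := hP.exists_intertwining (W := g.Enveloping ⧸ g.evenIdeal)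
    (S := g.even) (ad := g.adOdd) (br := fun y z => g.oddBracket y z) (fun _ _ => rfl)
    g.adOdd_oddCurvature (a := fun X => a X) (b := a ∘ₗ g.odd.subtype)
    (fun X y => by
      refine LinearMap.ext fun m => ?_
      have h := congrArg (· • m) (g.toEnveloping_even_odd X y)
      simp only [mul_smul, add_smul] at h
      exact h)
    (fun y z => by
      refine LinearMap.ext fun m => ?_
      have h := congrArg (· • m) (g.toEnveloping_odd_odd y z)
      simp only [mul_smul, add_smul] at h
      exact h)
    (v := g.evenIdeal.mkQ 1)
    (fun X => by
      rw [ha, ← map_smul, Submodule.mkQ_apply, Submodule.Quotient.mk_eq_zero, smul_eq_mul, mul_one]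
      exact Submodule.subset_span ⟨X, X.2, rfl⟩)
  have hs (u : g.Enveloping) : ∀ w, s (ρ u w) = u • s w := by
    induction u using g.enveloping_induction with
    | algebraMap c =>
      intro w
      rw [AlgHom.commutes, algebraMap_smul, Module.algebraMap_end_apply, map_smul]
    | even X => intro w; rw [hρ0]; exact hs0 X w
    | odd y => intro w; rw [hρ1]; exact hs1 y w
    | mul u v hu hv => intro w; rw [map_mul, Module.End.mul_apply, hu, hv, mul_smul]
    | add u v hu hv => intro w; rw [map_add, LinearMap.add_apply, map_add, hu, hv, add_smul]
  have hs_one (u : g.Enveloping) : s (ρ u 1) = g.evenIdeal.mkQ u := by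
    rw [hs, h1, ← map_smul, smul_eq_mul, mul_one]
  -- `1` generates the exterior algebra, so `s` is determined by `s (ρ u 1) = u`.
  have hcyc : LinearMap.range ((LinearMap.applyₗ (1 : ExteriorAlgebra K g.odd)) ∘ₗ
      ρ.toLinearMap) = ⊤ := by
    refine hP.eq_top_of_stable ⟨1, ?_⟩ ?_
    · simp
    · rintro y _ ⟨u, rfl⟩
      refine ⟨g.toEnveloping y * u, ?_⟩
      simp [hρ1]
  have hann : ∀ u ∈ g.evenIdeal, ρ u 1 = 0 := by
    intro u hu
    induction hu using Submodule.span_induction with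
    | mem u hu =>
      obtain ⟨X, hX, rfl⟩ := hu
      rw [hρ0 ⟨X, hX⟩]
      exact der_one _
    | zero => rw [map_zero, LinearMap.zero_apply]
    | add u v _ _ hu hv => rw [map_add, LinearMap.add_apply, hu, hv, add_zero]
    | smul c u _ hu => rw [smul_eq_mul, map_mul, Module.End.mul_apply, hu, map_zero]
  have hinj : Function.Injective s := by
    rw [injective_iff_map_eq_zero]
    intro w hw
    obtain ⟨u, hu⟩ : w ∈ LinearMap.range ((LinearMap.applyₗ (1 : ExteriorAlgebra K g.odd)) ∘ₗ
      ρ.toLinearMap) := hcyc ▸ Submodule.mem_top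
    have hu : ρ u 1 = w := hu
    rw [← hu, hs_one, Submodule.mkQ_apply, Submodule.Quotient.mk_eq_zero] at hw
    rw [← hu, hann u hw]
  have hsurj : Function.Surjective s := fun m => by
    obtain ⟨u, rfl⟩ := g.evenIdeal.mkQ_surjective m
    exact ⟨ρ u 1, hs_one u⟩
  exact ⟨LinearEquiv.ofBijective s ⟨hinj, hsurj⟩, hs0, hs1⟩

/-! ### The invariant elements -/

/-- If the even part acts on the odd part with trace zero, then the exterior algebra with the
deformed multiplications has a nonzero invariant element. -/
theorem exists_invariant_of_trace_eq_zero [IsAlgClosed K] [CharZero K] (g : LieSuperalgebra K L)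
    {P : g.odd →ₗ[K] Module.End K (ExteriorAlgebra K g.odd)}
    (hP : IsDeformation g.oddCurvature P) (htr : ∀ X, LinearMap.trace K g.odd (g.adOdd X) = 0) :
    ∃ w : ExteriorAlgebra K g.odd, w ≠ 0 ∧ (∀ X, der (g.adOdd X) w = 0) ∧
      ∀ y, wedge y w + P y w = 0 := by
  obtain ⟨t, ht, htder⟩ := exists_top_form K g.odd
  obtain ⟨i, hi⟩ := IsAlgClosed.exists_pow_nat_eq (-1 : K) (n := 2) two_pos
  have hi0 : i ≠ 0 := by rintro rfl; simp at hi
  -- The counit, as a linear form on the exterior algebra.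
  obtain ⟨ε, hε1, hε0, hεy⟩ := hP.exists_intertwining (W := K)
    (S := g.even) (ad := g.adOdd) (br := fun y z => g.oddBracket y z) (fun _ _ => rfl)
    g.adOdd_oddCurvature (a := fun _ => 0) (b := 0) (v := 1) (by simp) (by simp) (by simp)
  -- The dual of the exterior algebra is a module through the antiautomorphism of the enveloping
  -- algebra given by `X ↦ -X` on even elements and `y ↦ i y`, where `i ^ 2 = -1`, on odd ones.
  -- As the trace vanishes, the even part annihilates the linear form `t`.
  obtain ⟨s, hs1, hs0, hsy⟩ := hP.exists_intertwining
    (W := Module.Dual K (ExteriorAlgebra K g.odd))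
    (S := g.even) (ad := g.adOdd) (br := fun y z => g.oddBracket y z) (fun _ _ => rfl)
    g.adOdd_oddCurvature
    (a := fun X => -Module.Dual.transpose (der (g.adOdd X)))
    (b := i • (Module.Dual.transpose ∘ₗ (wedge + P)))
    (fun X y => by
      refine LinearMap.ext fun f => LinearMap.ext fun w => ?_
      have h1 := congrArg f (LinearMap.congr_fun (der_mul_wedge (g.adOdd X) y) w)
      have h2 := congrArg f
        (LinearMap.congr_fun (hP.equivariant _ (g.adOdd_oddCurvature X) y) w)
      simp [Module.Dual.transpose_apply] at h1 h2 ⊢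
      linear_combination i * h1 + i * h2)
    (fun y z => by
      refine LinearMap.ext fun f => LinearMap.ext fun w => ?_
      have h := congrArg f (LinearMap.congr_fun (hP.anticomm y z) w)
      rw [oddCurvature_apply] at h
      simp [Module.Dual.transpose_apply] at h ⊢
      linear_combination i ^ 2 * h + f (der (g.adOdd (g.oddBracket y z)) w) * hi)
    (v := t)
    (fun X => by
      refine LinearMap.ext fun w => ?_
      simp [Module.Dual.transpose_apply, htder, htr])
  have hsy' (y : g.odd) (w m : ExteriorAlgebra K g.odd) :
      s (wedge y w + P y w) m = i * s w (wedge y m + P y m) := by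
    rw [hsy]
    simp [Module.Dual.transpose_apply, mul_add]
  have hs0' (X : g.even) (w m : ExteriorAlgebra K g.odd) :
      s (der (g.adOdd X) w) m = -s w (der (g.adOdd X) m) := by
    rw [hs0]
    simp [Module.Dual.transpose_apply]
  -- The elements on which all forms in the range of `s` vanish form a stable subspace.
  have hflip : Function.Injective s.flip := by
    rw [← LinearMap.ker_eq_bot]
    refine eq_bot_of_stable hP.lowers (fun y m hm => ?_) (fun m hm => ?_)
    · refine LinearMap.ext fun w => ?_
      have h := LinearMap.congr_fun (LinearMap.mem_ker.1 hm) (wedge y w + P y w)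
      rw [LinearMap.flip_apply, hsy', LinearMap.zero_apply, mul_eq_zero] at h
      exact h.resolve_left hi0
    · have h := LinearMap.congr_fun (LinearMap.mem_ker.1 hm) 1
      rw [LinearMap.flip_apply, hs1] at h
      exact (ht m).1 h
  have hsurj : Function.Surjective s := LinearMap.flip_injective_iff₁.1 hflip
  have hinj : Function.Injective s :=
    (LinearMap.injective_iff_surjective_of_finrank_eq_finrank
      (Subspace.dual_finrank_eq (K := K) (V := ExteriorAlgebra K g.odd)).symm).2 hsurj
  obtain ⟨w, hw⟩ := hsurj ε
  refine ⟨w, ?_, fun X => hinj (LinearMap.ext fun m => ?_),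
    fun y => hinj (LinearMap.ext fun m => ?_)⟩
  · rintro rfl
    rw [map_zero] at hw
    rw [← hw, LinearMap.zero_apply] at hε1
    exact zero_ne_one hε1
  · rw [hs0', hw, hε0, map_zero, LinearMap.zero_apply, LinearMap.zero_apply, neg_zero]
  · rw [hsy', hw, hεy, map_zero, LinearMap.zero_apply, LinearMap.zero_apply, LinearMap.zero_apply,
      mul_zero]

end LieSuperalgebra

open ExteriorAlgebra LieSuperalgebra in
theorem lemma5p1 {K : Type*} [Field K] [IsAlgClosed K] [CharZero K]
    {L : Type*} [AddCommGroup L] [Module K L] [FiniteDimensional K L]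
    (g : LieSuperalgebra K L) :
    Module.rank K (g.invariants (g.Enveloping ⧸ g.evenIdeal)) ≤ 1 ∧
      (Module.rank K (g.invariants (g.Enveloping ⧸ g.evenIdeal)) = 1 ↔
        ∀ X : g.even, LinearMap.trace K g.odd (g.adOdd X) = 0) := by
  obtain ⟨P, hP⟩ := g.exists_isDeformation_oddCurvature
  obtain ⟨s, hs0, hsy⟩ := g.exists_equiv_exteriorAlgebra hP
  obtain ⟨t, ht, htder⟩ := exists_top_form K g.odd
  have hinv (w : ExteriorAlgebra K g.odd) :
      s w ∈ g.invariants (g.Enveloping ⧸ g.evenIdeal) ↔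
        (∀ X, der (g.adOdd X) w = 0) ∧ ∀ y, wedge y w + P y w = 0 := by
    simp only [mem_invariants_iff, ← hs0, ← hsy, LinearEquiv.map_eq_zero_iff]
  -- The invariant elements below the top degree form a stable subspace.
  have hbot : LinearMap.ker t ⊓ (g.invariants (g.Enveloping ⧸ g.evenIdeal)).comap
      s.toLinearMap = ⊥ := by
    refine eq_bot_of_stable hP.lowers (fun y w hw => ?_) fun w hw => (ht w).1 hw.1
    rw [((hinv w).1 hw.2).2 y]
    exact Submodule.zero_mem _
  -- The top degree form is injective on invariant elements.
  let f : g.invariants (g.Enveloping ⧸ g.evenIdeal) →ₗ[K] K :=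
    t ∘ₗ s.symm.toLinearMap ∘ₗ Submodule.subtype _
  have hf : Function.Injective f := by
    rw [injective_iff_map_eq_zero]
    intro z hz
    have h : s.symm z ∈ LinearMap.ker t ⊓ (g.invariants (g.Enveloping ⧸ g.evenIdeal)).comap
        s.toLinearMap := ⟨hz, by simp⟩
    rw [hbot, Submodule.mem_bot, LinearEquiv.map_eq_zero_iff] at h
    exact Subtype.ext h
  have hle : Module.rank K (g.invariants (g.Enveloping ⧸ g.evenIdeal)) ≤ 1 := by
    have h := LinearMap.lift_rank_le_of_injective f hf
    rw [Module.rank_self, Cardinal.lift_one] at h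
    simpa using h
  refine ⟨hle, fun hrank X => ?_, fun htr => ?_⟩
  · have hne : Module.rank K (g.invariants (g.Enveloping ⧸ g.evenIdeal)) ≠ 0 := by
      rw [hrank]; exact one_ne_zero
    obtain ⟨z, hz⟩ := rank_pos_iff_exists_ne_zero.1 (pos_iff_ne_zero.2 hne)
    have hz' : t (s.symm z) ≠ 0 := fun h => hz (hf (h.trans (map_zero f).symm))
    have hw : s (s.symm z) ∈ g.invariants (g.Enveloping ⧸ g.evenIdeal) := by simp
    have h := htder (g.adOdd X) (s.symm z)
    rw [((hinv _).1 hw).1 X, map_zero] at h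
    exact (mul_eq_zero.1 h.symm).resolve_right hz'
  · obtain ⟨w, hw0, hw⟩ := g.exists_invariant_of_trace_eq_zero hP htr
    refine le_antisymm hle (Cardinal.one_le_iff_pos.2 (rank_pos_iff_exists_ne_zero.2
      ⟨⟨s w, (hinv w).2 hw⟩, fun h => hw0 ?_⟩))
    exact s.map_eq_zero_iff.1 (congrArg Subtype.val h)
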